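/- **Setting.** A Bayesian network design game has $n$ players, a finite ground set $E$ with costs $c_e\ge 0$, a type space $T$, and for each player $i$ and type $t\in T$ a collection $\mathcal F_i(t)\subseteq 2^E$ of feasible actions. Types $t_i\sim\pi_i$ are drawn independently. Under an action profile $a=(a_1,\dots,a_n)$ with $a_i\in\mathcal F_i(t_i)$, the users of an element share its cost equally: $c_i(a)=\sum_{e\in a_i} c_e/n_e(a)$, where $n_e(a)=|\{j: e\in a_j\}|$. The social cost is $C(a)=\sum_i c_i(a)$. A strategy of player $i$ is a map $s_i:T\to 2^E$ with $s_i(t)\in\mathcal F_i(t)$ for every $t$. Put $K(s)=\mathbb E_t[C(s_1(t_1),\dots,s_n(t_n))]$ and $\mathrm{OPT}(t)=\min\{C(a): a_i\in\mathcal F_i(t_i)\ \forall i\}$. A strategy profile $s$ is a Bayes–Nash equilibrium (BNE) if for all $i$, $t_i\in T$ and $a_i'\in\mathcal F_i(t_i)$, $$\mathbb E_{t_{-i}}[c_i(s_i(t_i),s_{-i}(t_{-i}))]\le \mathbb E_{t_{-i}}[c_i(a_i',s_{-i}(t_{-i}))].$$ The information gap and the Bayesian price of stability are $$\mathcal{IG}=\frac{\min_{s}K(s)}{\mathbb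 E_t[\mathrm{OPT}(t)]},\qquad \mathrm{BPoS}=\min_{s\text{ is a BNE}}\frac{K(s)}{\mathbb E_t[\mathrm{OPT}(t)]},$$ with values in $[0,\infty]$, where $x/0=\infty$ for $x>0$, $0/0=0$, and a minimum over the empty set is $\infty$. Let $V$ be a finite set. The games considered are the following. * *Multicast:* $E$ is the edge set of an undirected graph $G$ on $V$ with nonnegative edge costs and a root $r\in V$. A type is a node $s$ connected to $r$ in $G$ (any node, if $G$ is connected); feasible actions are the (edge sets of) paths from $s$ to $r$. * *Undirected network design:* $E$ is the edge set of an undirected graph $G$ on $V$ with nonnegative edge costs. A type is a pair $(s,r)$ of nodes that are connected in $G$ (any pair, if $G$ is connected); feasible actions are the paths from $s$ to $r$. * *Vertex cover:* $E=V$ with nonnegative node costs; a type is a pair $(u,v)\in V\times V$, with feasible actions $\{u\}$ and $\{v\}$. * *$d$-hypergraph cover* ($d\ge 1$): $E=V$ with nonnegative node costs; a type is a set $h\subseteq V$ with $|h|=d$, with feasible actions $\{v\}$ for $v\in h$. **Theorem.** Suppose the types are i.i.d., i.e. $\pi_i=\rho$ for all $i$, for an arbitrary distribution $\rho$ on the type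 space. Then, for every number $n$ of players, the information gap is at most $3$ for the multicast game, at most $5$ for the undirected network design game, at most $6$ for the vertex cover game, and at most $2(d+1)$ for the $d$-hypergraph cover game. Moreover, there is an absolute constant $C>0$ such that for every $n\ge2$ and every such game with $n$ players, a BNE exists and $\mathrm{BPoS}\le C\log n$ for the first three games, and $\mathrm{BPoS}\le C\,(d+1)\log n$ for the $d$-hypergraph cover game. -/

import Mathlib

open scoped ENNReal NNReal

universe u

noncomputable section

/-- A Bayesian network design game with `n` players, common type space `T` and ground set `E`.
The action space of every player is the collection of all (finite) subsets of `E`; the types are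
drawn independently, the type of player `i` from `prior i`. -/
structure BayesianNetworkDesignGame (n : ℕ) (T : Type*) (E : Type*) where
  /-- the building cost `c_e ≥ 0` of an element -/
  elementCost : E → ℝ≥0
  /-- the collection `F_i(t_i)` of feasible actions of player `i` with type `t_i` -/
  feasible : Fin n → T → Set (Finset E)
  /-- the prior distribution of the type of player `i` -/
  prior : Fin n → PMF T

namespace BayesianNetworkDesignGame

variable {n : ℕ} {T E : Type*} (Γ : BayesianNetworkDesignGame n T E)

/-- `n_e(a)`: the number of players whose action contains `e`. -/
def congestion (a : Fin n → Finset E) (e : E) : ℕ :=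
  Nat.card {j : Fin n // e ∈ a j}

/-- `c_i(a) = ∑_{e ∈ a_i} c_e / n_e(a)`: the users of an element share its cost equally. -/
def playerCost (a : Fin n → Finset E) (i : Fin n) : ℝ≥0 :=
  ∑ e ∈ a i, Γ.elementCost e / (congestion a e : ℝ≥0)

/-- The social cost of an action profile: the sum of the costs of the players. -/
def socialCost (a : Fin n → Finset E) : ℝ≥0 :=
  ∑ i, Γ.playerCost a i

/-- Expectation over the type profile `t ∼ π_1 × ⋯ × π_n`. -/
def expect (f : (Fin n → T) → ℝ≥0∞) : ℝ≥0∞ :=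
  ∑' t : Fin n → T, (∏ i, Γ.prior i (t i)) * f t

/-- `s` is a profile of (pure) Bayesian strategies: each `s i` maps a type of player `i` to an
action that is feasible for that type. -/
def IsStrategyProfile (s : Fin n → T → Finset E) : Prop :=
  ∀ i t, s i t ∈ Γ.feasible i t

/-- `K(s)`: the expected social cost of a strategy profile. -/
def expectedSocialCost (s : Fin n → T → Finset E) : ℝ≥0∞ :=
  Γ.expect fun t => (Γ.socialCost fun i => s i (t i) : ℝ≥0)

/-- The minimum social cost over all action profiles that are feasible for the type profile `t`. -/
def optCost (t : Fin n → T) : ℝ≥0∞ :=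
  ⨅ a : {a : Fin n → Finset E // ∀ i, a i ∈ Γ.feasible i (t i)}, (Γ.socialCost a.1 : ℝ≥0∞)

/-- The expected cost of the ex-post optimal action profile. -/
def expectedOptCost : ℝ≥0∞ :=
  Γ.expect Γ.optCost

/-- The expected cost of player `i` for the action `a` when the other players use `s`. The summand
does not depend on the coordinate `t i`, so this is the expectation over `t_{-i}`. -/
def interimCost (s : Fin n → T → Finset E) (i : Fin n) (a : Finset E) : ℝ≥0∞ :=
  Γ.expect fun t => (Γ.playerCost (Function.update (fun j => s j (t j)) i a) i : ℝ≥0)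

/-- Bayes-Nash equilibrium: for every player and every type, the prescribed action minimises the
expected cost among the actions that are feasible for that type. -/
def IsBayesNash (s : Fin n → T → Finset E) : Prop :=
  Γ.IsStrategyProfile s ∧
    ∀ (i : Fin n) (t : T), ∀ a' ∈ Γ.feasible i t,
      Γ.interimCost s i (s i t) ≤ Γ.interimCost s i a'

/-- The information gap `min_s K(s) / E[OPT(t)]`. Values are in `[0, ∞]`, with `x / 0 = ∞` for
`x > 0` and `0 / 0 = 0`; hence `informationGap ≤ b` says `min_s K(s) ≤ b * E[OPT(t)]`. -/
def informationGap : ℝ≥0∞ :=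
  (⨅ s : {s : Fin n → T → Finset E // Γ.IsStrategyProfile s}, Γ.expectedSocialCost s.1) /
    Γ.expectedOptCost

/-- The Bayesian price of stability `min_{s is BNE} K(s) / E[OPT(t)]`, with values in `[0, ∞]`; it
is `∞` if there is no equilibrium. -/
def bayesianPriceOfStability : ℝ≥0∞ :=
  ⨅ s : {s : Fin n → T → Finset E // Γ.IsBayesNash s},
    Γ.expectedSocialCost s.1 / Γ.expectedOptCost

end BayesianNetworkDesignGame

/-- The edge sets of the paths from `s` to `r` in `G`. -/
def pathEdgeSets {V : Type*} (G : SimpleGraph V) (s r : V) : Set (Finset G.edgeSet) :=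
  {a | ∃ p : G.Walk s r, p.IsPath ∧ ∀ e : G.edgeSet, e ∈ a ↔ (e : Sym2 V) ∈ p.edges}

/-- The Bayesian multicast game on the graph `G` with edge costs `c` and root `r`. A type is a
source node that can be connected to the root (every node, if `G` is connected); the feasible
actions are the paths from the source to the root. -/
def multicastGame {V : Type*} (G : SimpleGraph V) (c : G.edgeSet → ℝ≥0) (r : V) {n : ℕ}
    (π : Fin n → PMF {s : V // G.Reachable s r}) :
    BayesianNetworkDesignGame n {s : V // G.Reachable s r} G.edgeSet where
  elementCost := c
  feasible _ t := pathEdgeSets G t.1 r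
  prior := π

/-- The Bayesian undirected network design game on the graph `G` with edge costs `c`. A type is a
source-sink pair that can be connected (every pair of nodes, if `G` is connected); the feasible
actions are the paths from the source to the sink. -/
def undirectedGame {V : Type*} (G : SimpleGraph V) (c : G.edgeSet → ℝ≥0) {n : ℕ}
    (π : Fin n → PMF {p : V × V // G.Reachable p.1 p.2}) :
    BayesianNetworkDesignGame n {p : V × V // G.Reachable p.1 p.2} G.edgeSet where
  elementCost := c
  feasible _ t := pathEdgeSets G t.1.1 t.1.2
  prior := π

/-- The Bayesian vertex cover game with node costs `c`. A type is a pair of nodes, and the player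
has to choose one of the two. -/
def vertexCoverGame {V : Type*} (c : V → ℝ≥0) {n : ℕ} (π : Fin n → PMF (V × V)) :
    BayesianNetworkDesignGame n (V × V) V where
  elementCost := c
  feasible _ t := {{t.1}, {t.2}}
  prior := π

/-- The Bayesian `d`-hypergraph cover game with node costs `c`. A type is a set of `d` nodes, and
the player has to choose one of them. -/
def hypergraphCoverGame {V : Type*} (d : ℕ) (c : V → ℝ≥0) {n : ℕ}
    (π : Fin n → PMF {h : Finset V // h.card = d}) :
    BayesianNetworkDesignGame n {h : Finset V // h.card = d} V where
  elementCost := c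
  feasible _ t := {a | ∃ v ∈ t.1, a = {v}}
  prior := π

end

/-! The information gap is bounded by sampling. Fix a sample `Y` of n - 1 types, buy a solution `B
Y` for it, and let each player choose an action that is cheap to add to `B Y`. This is a strategy
profile, and it costs at most the price of `B Y` plus n times the expected augmentation cost of one
fresh type. As types are i.i.d., the sample and the fresh type together are a full profile X with
one coordinate held out. Averaging over the held-out coordinate, it suffices to compare with OPT(X)
for each fixed X (`iInf_expectedSocialCost_le_of_sampling`). Each game then needs a solution rule
whose cost, and whose augmentation cost summed over all held-out coordinates, are small multiples of
OPT(X).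

For cover games the rule is the local-ratio algorithm: solution and augmentations cost at most d
times OPT each. For multicast it is a minimum Steiner tree (factor 1), and joining each terminal to
the nearest other one costs twice OPT by disjoint balls (`sum_nearest_le`).

For undirected network design the rule is a forest minimising its weight plus twice the length of
one dominating pair per component; this penalty makes merging components expensive
(`IsOptimalForest.merge`). Let A be any solution for X and L the sum, over the components of A, of
the length of the longest pair. The forest costs at most w(A) + 2L. To bound the augmentation costs
g, pairs are processed by increasing length, and for each pair balls of total radius g/3 around its
ends are contracted (`IsOptimalForest.exists_balls`). The edges of A lose length at each
contraction, and accounting for the loss gives total augmentation at most 3w(A) - L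
(`sum_augment_le`). As L ≤ w(A), the sum is at most 5w(A).

For the price of stability, the expected Rosenthal potential is an exact potential of the Bayesian
game and lies between the social cost and its n-th harmonic multiple. Hence a minimiser is an
equilibrium losing only a factor H_n against every strategy profile (`exists_isBayesNash`). -/

namespace BayesianNetworkDesignGame

/-! ### Expectations over independent types, and the social cost as the cost of a union. -/

section General

variable {n : ℕ} {T E : Type*} (Γ : BayesianNetworkDesignGame n T E)

theorem sum_prod_insertNth {m : ℕ} {T : Type*} [Fintype T] (p : Fin (m + 1) → T → ℝ≥0∞)
    (j : Fin (m + 1)) (F : (Fin (m + 1) → T) → ℝ≥0∞) :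
    ∑ X : Fin (m + 1) → T, (∏ i, p i (X i)) * F X =
      ∑ x : T, p j x * ∑ Y : Fin m → T, (∏ i, p (j.succAbove i) (Y i)) * F (j.insertNth x Y) := by
  rw [← (Fin.insertNthEquiv (fun _ => T) j).sum_comp, Fintype.sum_prod_type]
  refine Finset.sum_congr rfl fun x _ => ?_
  rw [Finset.mul_sum]
  refine Finset.sum_congr rfl fun Y _ => ?_
  rw [Fin.prod_univ_succAbove _ j]
  simp [Fin.insertNthEquiv, mul_assoc]

theorem expect_eq_sum [Fintype T] (f : (Fin n → T) → ℝ≥0∞) :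
    Γ.expect f = ∑ t : Fin n → T, (∏ i, Γ.prior i (t i)) * f t := by
  rw [expect, tsum_fintype]

theorem expect_mono {f g : (Fin n → T) → ℝ≥0∞} (h : ∀ t, f t ≤ g t) :
    Γ.expect f ≤ Γ.expect g :=
  ENNReal.tsum_le_tsum fun t => by gcongr; exact h t

theorem expect_const_mul (c : ℝ≥0∞) (f : (Fin n → T) → ℝ≥0∞) :
    Γ.expect (fun t => c * f t) = c * Γ.expect f := by
  rw [expect, expect, ← ENNReal.tsum_mul_left]
  exact tsum_congr fun t => by ring

theorem expect_add (f g : (Fin n → T) → ℝ≥0∞) :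
    Γ.expect (fun t => f t + g t) = Γ.expect f + Γ.expect g := by
  simp only [expect, mul_add, ENNReal.tsum_add]

theorem expect_finset_sum {ι : Type*} (S : Finset ι) (f : ι → (Fin n → T) → ℝ≥0∞) :
    Γ.expect (fun t => ∑ i ∈ S, f i t) = ∑ i ∈ S, Γ.expect (f i) := by
  classical
  induction S using Finset.induction_on with
  | empty => simp [expect]
  | insert a S ha ih => simp only [Finset.sum_insert ha, expect_add, ih]

theorem sum_prior [Fintype T] (i : Fin n) : ∑ x, Γ.prior i x = 1 := by
  rw [← tsum_fintype (L := .unconditional _)]; exact (Γ.prior i).tsum_coe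

theorem expect_const [Fintype T] (c : ℝ≥0∞) : Γ.expect (fun _ => c) = c := by
  rw [expect_eq_sum, ← Finset.sum_mul, ← Fintype.prod_sum]
  simp [sum_prior]

/-- Conditioning on the type of player `i`. -/
theorem expect_condition [Fintype T] (i : Fin n) (F : T → (Fin n → T) → ℝ≥0∞)
    (hF : ∀ x t t', (∀ j, j ≠ i → t j = t' j) → F x t = F x t') :
    Γ.expect (fun t => F (t i) t) = ∑ x, Γ.prior i x * Γ.expect (F x) := by
  obtain _ | m := n
  · exact i.elim0
  simp only [expect_eq_sum]
  rw [sum_prod_insertNth (fun i => Γ.prior i) i]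
  refine Finset.sum_congr rfl fun x _ => ?_
  rw [sum_prod_insertNth (fun i => Γ.prior i) i]
  have : ∀ (x' : T) (Y : Fin m → T), F x (i.insertNth x' Y) = F x (i.insertNth x Y) := by
    intro x' Y
    apply hF
    intro j hj
    obtain ⟨k, rfl⟩ := Fin.exists_succAbove_eq hj
    simp
  simp only [Fin.insertNth_apply_same, this]
  rw [← Finset.sum_mul, sum_prior, one_mul]

theorem expect_marginal [Fintype T] (i : Fin n) (f : T → ℝ≥0∞) :
    Γ.expect (fun t => f (t i)) = ∑ x, Γ.prior i x * f x := by
  rw [expect_condition Γ i (fun x _ => f x) (fun _ _ _ _ => rfl)]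
  simp [expect_const]

open Classical in
/-- The social cost is the total cost of the elements that are used. -/
theorem socialCost_eq [Fintype E] (a : Fin n → Finset E) :
    Γ.socialCost a = ∑ e, if 0 < congestion a e then Γ.elementCost e else 0 := by
  have h : ∀ i, Γ.playerCost a i =
      ∑ e, if e ∈ a i then Γ.elementCost e / (congestion a e : ℝ≥0) else 0 := by
    intro i
    rw [playerCost, ← Finset.sum_filter]
    simp
  simp only [socialCost, h]
  rw [Finset.sum_comm]
  refine Finset.sum_congr rfl fun e _ => ?_
  rw [← Finset.sum_filter, Finset.sum_const]
  have hc : (Finset.univ.filter fun i => e ∈ a i).card = congestion a e := by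
    rw [congestion, Nat.card_eq_fintype_card, Fintype.card_subtype]
  rw [hc]
  split_ifs with h0
  · have : (congestion a e : ℝ≥0) ≠ 0 := by exact_mod_cast h0.ne'
    rw [nsmul_eq_mul]; field_simp
  · have : congestion a e = 0 := by omega
    simp [this]

theorem congestion_pos [Finite E] {a : Fin n → Finset E} {e : E} :
    0 < congestion a e ↔ ∃ i, e ∈ a i := by
  rw [congestion, Nat.card_pos_iff]
  constructor
  · rintro ⟨⟨i, hi⟩, _⟩; exact ⟨i, hi⟩
  · rintro ⟨i, hi⟩; exact ⟨⟨i, hi⟩, inferInstance⟩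

/-- The cost of a set of elements. -/
noncomputable def cost (S : Finset E) : ℝ≥0 := ∑ e ∈ S, Γ.elementCost e

theorem cost_mono {S S' : Finset E} (h : S ⊆ S') : Γ.cost S ≤ Γ.cost S' :=
  Finset.sum_le_sum_of_subset h

open Classical in
theorem cost_union_le (S S' : Finset E) : Γ.cost (S ∪ S') ≤ Γ.cost S + Γ.cost S' := by
  rw [cost, cost, cost, ← Finset.sum_union_inter]; exact le_self_add

open Classical in
theorem cost_biUnion_le {ι : Type*} (I : Finset ι) (S : ι → Finset E) :
    Γ.cost (I.biUnion S) ≤ ∑ i ∈ I, Γ.cost (S i) := by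
  induction I using Finset.induction_on with
  | empty => simp [cost]
  | insert a I ha ih =>
    rw [Finset.biUnion_insert, Finset.sum_insert ha]
    exact (Γ.cost_union_le _ _).trans (by gcongr)

open Classical in
theorem socialCost_eq_cost [Finite E] (a : Fin n → Finset E) :
    Γ.socialCost a = Γ.cost (Finset.univ.biUnion a) := by
  have := Fintype.ofFinite E
  rw [socialCost_eq, cost, ← Finset.sum_filter]
  refine Finset.sum_congr ?_ fun _ _ => rfl
  ext e
  simp [congestion_pos]

end General

/-! ### The reduction to sampling and augmenting. -/

section Sampling

variable {m : ℕ} {T E : Type*} (Γ : BayesianNetworkDesignGame (m + 1) T E)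

-- The elements in use lie in `B` together with what each single action adds to `B`; equal priors
-- make the m + 1 expected additions equal.
open Classical in
theorem expectedSocialCost_le_of_bought [Fintype T] [Finite E] {ρ : PMF T}
    (hρ : ∀ i, Γ.prior i = ρ) (B : Finset E) (s : T → Finset E) :
    Γ.expectedSocialCost (fun _ => s) ≤
      Γ.cost B + ((m + 1 : ℕ) : ℝ≥0∞) * ∑ x, ρ x * (Γ.cost (s x \ B) : ℝ≥0) := by
  have h1 : ∀ t : Fin (m + 1) → T, ((Γ.socialCost fun i => s (t i) : ℝ≥0) : ℝ≥0∞) ≤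
      Γ.cost B + ∑ i, ((Γ.cost (s (t i) \ B) : ℝ≥0) : ℝ≥0∞) := by
    intro t
    rw [socialCost_eq_cost, ← ENNReal.ofNNReal_finsetSum, ← ENNReal.coe_add, ENNReal.coe_le_coe]
    refine le_trans (Γ.cost_mono (S' := B ∪ Finset.univ.biUnion fun i => s (t i) \ B) ?_)
      ((Γ.cost_union_le _ _).trans (by gcongr; exact Γ.cost_biUnion_le _ _))
    intro e he
    simp only [Finset.mem_biUnion, Finset.mem_union, Finset.mem_sdiff] at he ⊢
    obtain ⟨i, hi, hei⟩ := he
    by_cases heB : e ∈ B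
    · exact Or.inl heB
    · exact Or.inr ⟨i, hi, hei, heB⟩
  refine (Γ.expect_mono h1).trans ?_
  rw [expect_add, expect_const, expect_finset_sum]
  have h2 : ∀ i : Fin (m + 1),
      Γ.expect (fun t => ((Γ.cost (s (t i) \ B) : ℝ≥0) : ℝ≥0∞)) =
        ∑ x, ρ x * (Γ.cost (s x \ B) : ℝ≥0) := fun i => by
    rw [expect_marginal Γ i (fun x => ((Γ.cost (s x \ B) : ℝ≥0) : ℝ≥0∞)), hρ]
  simp [h2]

open Classical in
/-- A strategy that buys a solution `B Y` for a sample `Y` of the other players' types and augments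
it with `s Y` bounds the best expected social cost, by exchangeability of i.i.d. types. -/
theorem iInf_expectedSocialCost_le_of_sampling [Finite T] [Finite E] {ρ : PMF T}
    (hρ : ∀ i, Γ.prior i = ρ) (B : (Fin m → T) → Finset E) (s : (Fin m → T) → T → Finset E)
    (hs : ∀ Y t i, s Y t ∈ Γ.feasible i t) (β : ℝ≥0) (hβ : β ≠ 0)
    (H : ∀ (X : Fin (m + 1) → T) (a : Fin (m + 1) → Finset E),
      (∀ i, a i ∈ Γ.feasible i (X i)) →
      ∑ j : Fin (m + 1), Γ.cost (B (j.removeNth X)) +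
        (m + 1 : ℕ) * ∑ j : Fin (m + 1), Γ.cost (s (j.removeNth X) (X j) \ B (j.removeNth X)) ≤
      (m + 1 : ℕ) * (β * Γ.cost (Finset.univ.biUnion a))) :
    (⨅ s : {s : Fin (m + 1) → T → Finset E // Γ.IsStrategyProfile s}, Γ.expectedSocialCost s.1) ≤
      β * Γ.expectedOptCost := by
  have := Fintype.ofFinite T
  set I := ⨅ s : {s : Fin (m + 1) → T → Finset E // Γ.IsStrategyProfile s},
    Γ.expectedSocialCost s.1 with hI
  have hpsum : ∑ Y : Fin m → T, ∏ i, ρ (Y i) = 1 := by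
    rw [← Fintype.prod_sum (fun _ x => ρ x)]
    have : ∑ x, ρ x = 1 := by rw [← Γ.sum_prior 0, hρ]
    simp [this]
  let G : (Fin m → T) → T → ℝ≥0∞ := fun Y x =>
    Γ.cost (B Y) + ((m + 1 : ℕ) : ℝ≥0∞) * (Γ.cost (s Y x \ B Y) : ℝ≥0)
  have hK : ∀ Y, I ≤ ∑ x, ρ x * G Y x := by
    intro Y
    have h1 : I ≤ Γ.expectedSocialCost (fun _ => s Y) :=
      iInf_le (fun s : {s : Fin (m + 1) → T → Finset E // Γ.IsStrategyProfile s} =>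
        Γ.expectedSocialCost s.1) ⟨fun _ => s Y, fun i t => hs Y t i⟩
    refine (h1.trans (Γ.expectedSocialCost_le_of_bought hρ (B Y) (s Y))).trans (le_of_eq ?_)
    have : ∑ x, ρ x = 1 := by rw [← Γ.sum_prior 0, hρ]
    simp only [G, mul_add, Finset.sum_add_distrib]
    rw [← Finset.sum_mul, this, one_mul, Finset.mul_sum]
    congr 1
    exact Finset.sum_congr rfl fun x _ => by ring
  -- Under the product law, coordinate `j` is a fresh type independent of the others, which form the
  -- sample.
  have hj : ∀ j : Fin (m + 1), I ≤ Γ.expect fun X => G (j.removeNth X) (X j) := by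
    intro j
    rw [expect_eq_sum, sum_prod_insertNth (fun i => Γ.prior i) j]
    simp only [Fin.insertNth_apply_same, Fin.removeNth_insertNth, hρ]
    calc I = ∑ Y : Fin m → T, (∏ i, ρ (Y i)) * I := by rw [← Finset.sum_mul, hpsum, one_mul]
      _ ≤ ∑ Y : Fin m → T, (∏ i, ρ (Y i)) * ∑ x, ρ x * G Y x := by
          gcongr with Y; exact hK Y
      _ = _ := by
          simp only [Finset.mul_sum]
          rw [Finset.sum_comm]
          exact Finset.sum_congr rfl fun x _ => Finset.sum_congr rfl fun Y _ => by ring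
  have hsum : ((m + 1 : ℕ) : ℝ≥0∞) * I ≤
      ((m + 1 : ℕ) : ℝ≥0∞) * (β * Γ.expectedOptCost) := by
    calc ((m + 1 : ℕ) : ℝ≥0∞) * I = ∑ _j : Fin (m + 1), I := by simp
      _ ≤ ∑ j : Fin (m + 1), Γ.expect fun X => G (j.removeNth X) (X j) :=
          Finset.sum_le_sum fun j _ => hj j
      _ = Γ.expect fun X => ∑ j : Fin (m + 1), G (j.removeNth X) (X j) := by
          rw [expect_finset_sum]
      _ ≤ Γ.expect fun X => (((m + 1 : ℕ) : ℝ≥0∞) * β) * Γ.optCost X := by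
          refine Γ.expect_mono fun X => ?_
          -- A nonzero finite factor commutes with the infimum, after which `H` treats each feasible
          -- profile separately.
          rw [optCost, ENNReal.mul_iInf_of_ne (by simp [hβ])
            (ENNReal.mul_ne_top (by simp) (by simp))]
          refine le_iInf fun a => ?_
          rw [socialCost_eq_cost]
          have := H X a.1 a.2
          simp only [G, Finset.sum_add_distrib, ← Finset.mul_sum]
          rw [mul_assoc]
          exact_mod_cast this
      _ = _ := by rw [expect_const_mul, mul_assoc]; rfl
  exact (ENNReal.mul_le_mul_iff_right (by simp) (by simp)).1 hsum

end Sampling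

/-! ### Existence of a cheap equilibrium through the Rosenthal potential. -/

section Equilibrium

variable {n : ℕ} {T E : Type*} (Γ : BayesianNetworkDesignGame n T E)

/-- The harmonic numbers. -/
noncomputable def harm (k : ℕ) : ℝ≥0 := ∑ i ∈ Finset.range k, ((i + 1 : ℕ) : ℝ≥0)⁻¹

theorem harm_mono : Monotone harm := fun _ _ h =>
  Finset.sum_le_sum_of_subset (Finset.range_mono h)

theorem one_le_harm {k : ℕ} (hk : 0 < k) : 1 ≤ harm k := by
  refine le_trans ?_ (harm_mono hk)
  simp [harm]

/-- The Rosenthal potential. -/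
noncomputable def potential [Fintype E] (a : Fin n → Finset E) : ℝ≥0 :=
  ∑ e, Γ.elementCost e * harm (congestion a e)

open Classical in
theorem congestion_update (a : Fin n → Finset E) (i : Fin n) (b : Finset E) (e : E) :
    congestion (Function.update a i b) e =
      congestion (Function.update a i ∅) e + if e ∈ b then 1 else 0 := by
  simp only [congestion, Nat.card_eq_fintype_card, Fintype.card_subtype]
  have h1 : ∀ b : Finset E, (Finset.univ.filter fun j => e ∈ Function.update a i b j) =
      (Finset.univ.filter fun j => j ≠ i ∧ e ∈ a j) ∪ (if e ∈ b then {i} else ∅) := by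
    intro b
    ext j
    by_cases hj : j = i
    · subst hj; by_cases hb : e ∈ b <;> simp [hb]
    · by_cases hb : e ∈ b <;> simp [hj, hb]
  rw [h1, h1, Finset.card_union_of_disjoint]
  · by_cases hb : e ∈ b <;> simp [hb]
  · by_cases hb : e ∈ b <;> simp [hb]

-- Joining an element with k other users adds c_e / (k + 1) to its harmonic term, which is exactly
-- the share of the player who joins.
open Classical in
theorem potential_update [Fintype E] (a : Fin n → Finset E) (i : Fin n) (b : Finset E) :
    Γ.potential (Function.update a i b) =
      Γ.potential (Function.update a i ∅) + Γ.playerCost (Function.update a i b) i := by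
  have h : Γ.playerCost (Function.update a i b) i =
      ∑ e, if e ∈ b then Γ.elementCost e / (congestion (Function.update a i b) e : ℝ≥0) else 0 := by
    rw [playerCost, ← Finset.sum_filter]
    simp
  rw [h, potential, potential, ← Finset.sum_add_distrib]
  refine Finset.sum_congr rfl fun e _ => ?_
  rw [congestion_update]
  split_ifs with hb
  · rw [harm, Finset.sum_range_succ, mul_add, div_eq_mul_inv]; rfl
  · simp

theorem socialCost_le_potential [Fintype E] (a : Fin n → Finset E) :
    Γ.socialCost a ≤ Γ.potential a := by
  classical
  rw [socialCost_eq, potential]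
  refine Finset.sum_le_sum fun e _ => ?_
  split_ifs with h
  · exact le_mul_of_one_le_right (zero_le) (one_le_harm h)
  · exact zero_le

theorem potential_le [Fintype E] (a : Fin n → Finset E) :
    Γ.potential a ≤ harm n * Γ.socialCost a := by
  classical
  rw [socialCost_eq, potential, Finset.mul_sum]
  refine Finset.sum_le_sum fun e _ => ?_
  split_ifs with h
  · rw [mul_comm]
    gcongr
    refine harm_mono ?_
    rw [congestion, Nat.card_eq_fintype_card]
    exact (Fintype.card_subtype_le _).trans (by simp)
  · have : congestion a e = 0 := by omega
    simp [this, harm]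

/-- Only the second summand depends on the strategy of player `i`, and it separates over the types
of that player. So the expected potential can be compared type by type. -/
theorem expect_condition_strategy [Fintype T] [Fintype E] (s : Fin n → T → Finset E) (i : Fin n)
    (σ : T → Finset E) :
    Γ.expect (fun t => (Γ.potential fun j => Function.update s i σ j (t j) : ℝ≥0)) =
      Γ.expect (fun t => (Γ.potential (Function.update (fun j => s j (t j)) i ∅) : ℝ≥0)) +
        ∑ x, Γ.prior i x * Γ.interimCost s i (σ x) := by
  have h : ∀ t : Fin n → T, (fun j => Function.update s i σ j (t j)) =
      Function.update (fun j => s j (t j)) i (σ (t i)) := by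
    intro t
    ext1 j
    by_cases hj : j = i
    · subst hj; simp
    · simp [hj]
  simp only [h, potential_update Γ _ i (σ _), ENNReal.coe_add]
  rw [expect_add]
  congr 1
  rw [expect_condition Γ i (fun x t =>
    ((Γ.playerCost (Function.update (fun j => s j (t j)) i (σ x)) i : ℝ≥0) : ℝ≥0∞))]
  · rfl
  · intro x t t' htt
    have : Function.update (fun j => s j (t j)) i (σ x) =
        Function.update (fun j => s j (t' j)) i (σ x) := by
      ext1 j
      by_cases hj : j = i
      · subst hj; simp
      · simp [hj, htt j hj]
    rw [this]

theorem interimCost_ne_top [Fintype T] (s : Fin n → T → Finset E) (i : Fin n) (a : Finset E) :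
    Γ.interimCost s i a ≠ ∞ := by
  rw [interimCost, expect_eq_sum]
  refine (ENNReal.sum_lt_top.2 fun t _ => ENNReal.mul_lt_top ?_ (by simp)).ne
  exact ENNReal.prod_lt_top fun i _ => (PMF.apply_lt_top _ _)

open Classical in
/-- A Bayes-Nash equilibrium whose expected cost exceeds that of any strategy profile at most by a
harmonic factor. -/
theorem exists_isBayesNash [Finite T] [Finite E] (hne : ∀ i t, (Γ.feasible i t).Nonempty) :
    ∃ s, Γ.IsBayesNash s ∧ ∀ s', Γ.IsStrategyProfile s' →
      Γ.expectedSocialCost s ≤ harm n * Γ.expectedSocialCost s' := by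
  have := Fintype.ofFinite T
  have := Fintype.ofFinite E
  let Φ : (Fin n → T → Finset E) → ℝ≥0∞ := fun s =>
    Γ.expect (fun t => (Γ.potential fun j => s j (t j) : ℝ≥0))
  obtain ⟨s, hs, hmin⟩ := Set.exists_min_image {s | Γ.IsStrategyProfile s} Φ (Set.toFinite _)
    ⟨fun i t => (hne i t).some, fun i t => (hne i t).some_mem⟩
  -- For a deviation at the single type `t` all other terms cancel by finiteness, and the positive
  -- weight of `t` can be divided out.
  have hpos : ∀ i t, Γ.prior i t ≠ 0 → ∀ a' ∈ Γ.feasible i t,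
      Γ.interimCost s i (s i t) ≤ Γ.interimCost s i a' := by
    intro i t ht a' ha'
    have hfeas : Γ.IsStrategyProfile (Function.update s i (Function.update (s i) t a')) := by
      intro j x
      by_cases hj : j = i
      · subst hj
        by_cases hx : x = t
        · subst hx; simpa using ha'
        · simpa [hx] using hs j x
      · simpa [hj] using hs j x
    have h1 := hmin _ hfeas
    have h2 : Φ s = Φ (Function.update s i (s i)) := by rw [Function.update_eq_self]
    rw [h2] at h1
    simp only [Φ] at h1
    rw [expect_condition_strategy, expect_condition_strategy] at h1
    have h3 := (ENNReal.add_le_add_iff_left (by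
      rw [expect_eq_sum]
      refine (ENNReal.sum_lt_top.2 fun t _ => ENNReal.mul_lt_top ?_ (by simp)).ne
      exact ENNReal.prod_lt_top fun i _ => (PMF.apply_lt_top _ _))).1 h1
    rw [← Finset.add_sum_erase _ _ (Finset.mem_univ t),
      ← Finset.add_sum_erase _ _ (Finset.mem_univ t)] at h3
    have h4 : ∑ x ∈ Finset.univ.erase t,
        Γ.prior i x * Γ.interimCost s i (Function.update (s i) t a' x) =
        ∑ x ∈ Finset.univ.erase t, Γ.prior i x * Γ.interimCost s i (s i x) :=
      Finset.sum_congr rfl fun x hx => by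
        rw [Function.update_of_ne (Finset.ne_of_mem_erase hx)]
    rw [h4] at h3
    have h5 := (ENNReal.add_le_add_iff_right (by
      refine (ENNReal.sum_lt_top.2 fun x _ => ENNReal.mul_lt_top ?_ ?_).ne
      · exact PMF.apply_lt_top _ _
      · exact (Γ.interimCost_ne_top s i _).lt_top)).1 h3
    rw [Function.update_self] at h5
    exact (ENNReal.mul_le_mul_iff_right ht (PMF.apply_ne_top _ _)).1 h5
  -- Minimality says nothing about types of probability zero, for which the equilibrium condition is
  -- still required. They are given best responses, which by `hae` changes no expectation.
  have hbr : ∀ i t, ∃ a ∈ Γ.feasible i t, ∀ a' ∈ Γ.feasible i t,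
      Γ.interimCost s i a ≤ Γ.interimCost s i a' := fun i t =>
    Set.exists_min_image _ _ (Set.toFinite _) (hne i t)
  choose br hbr1 hbr2 using hbr
  let s' : Fin n → T → Finset E := fun i t => if Γ.prior i t = 0 then br i t else s i t
  have hs' : Γ.IsStrategyProfile s' := by
    intro i t
    by_cases h : Γ.prior i t = 0
    · simpa [s', h] using hbr1 i t
    · simpa [s', h] using hs i t
  have hae : ∀ (f : (Fin n → Finset E) → ℝ≥0∞),
      Γ.expect (fun t => f fun j => s' j (t j)) = Γ.expect (fun t => f fun j => s j (t j)) := by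
    intro f
    simp only [expect_eq_sum]
    refine Finset.sum_congr rfl fun t _ => ?_
    by_cases h : ∃ i, Γ.prior i (t i) = 0
    · obtain ⟨i, hi⟩ := h
      rw [Finset.prod_eq_zero (Finset.mem_univ i) hi]; simp
    · push Not at h
      have : (fun j => s' j (t j)) = fun j => s j (t j) := by ext1 j; simp [s', h j]
      rw [this]
  have hint : ∀ i a, Γ.interimCost s' i a = Γ.interimCost s i a := fun i a =>
    hae fun b => ((Γ.playerCost (Function.update b i a) i : ℝ≥0) : ℝ≥0∞)
  refine ⟨s', ⟨hs', fun i t a' ha' => ?_⟩, fun s'' hs'' => ?_⟩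
  · rw [hint, hint]
    by_cases h : Γ.prior i t = 0
    · simpa [s', h] using hbr2 i t a' ha'
    · simpa [s', h] using hpos i t h a' ha'
  · calc Γ.expectedSocialCost s' = Γ.expectedSocialCost s :=
          hae fun b => ((Γ.socialCost b : ℝ≥0) : ℝ≥0∞)
      _ ≤ Φ s := Γ.expect_mono fun t => by
          exact_mod_cast Γ.socialCost_le_potential _
      _ ≤ Φ s'' := hmin _ hs''
      _ ≤ Γ.expect fun t => harm n * (Γ.socialCost fun j => s'' j (t j) : ℝ≥0) :=
          Γ.expect_mono fun t => by exact_mod_cast Γ.potential_le _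
      _ = _ := Γ.expect_const_mul _ _

theorem informationGap_le {β : ℝ≥0∞}
    (h : (⨅ s : {s : Fin n → T → Finset E // Γ.IsStrategyProfile s}, Γ.expectedSocialCost s.1) ≤
      β * Γ.expectedOptCost) : Γ.informationGap ≤ β :=
  ENNReal.div_le_of_le_mul h

theorem bayesianPriceOfStability_le [Finite T] [Finite E]
    (hne : ∀ i t, (Γ.feasible i t).Nonempty) {β : ℝ≥0∞}
    (h : (⨅ s : {s : Fin n → T → Finset E // Γ.IsStrategyProfile s}, Γ.expectedSocialCost s.1) ≤
      β * Γ.expectedOptCost) : Γ.bayesianPriceOfStability ≤ harm n * β := by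
  obtain ⟨s, hs, hle⟩ := Γ.exists_isBayesNash hne
  refine (iInf_le _ ⟨s, hs⟩).trans (ENNReal.div_le_of_le_mul ?_)
  rw [mul_assoc]
  refine le_trans ?_ (mul_le_mul_right h _)
  -- The factor `harm 0 = 0` is excluded before the infimum is multiplied; without players the left
  -- side is 0.
  by_cases hn : n = 0
  · subst hn
    have : Γ.expectedSocialCost s = 0 := by simp [expectedSocialCost, expect, socialCost]
    simp [this]
  have h0 : harm n ≠ 0 := (zero_lt_one.trans_le (one_le_harm (Nat.pos_of_ne_zero hn))).ne'
  rw [ENNReal.mul_iInf_of_ne (by simpa using h0) (by simp)]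
  exact le_iInf fun s' => hle s'.1 s'.2

/-- With no players there is nothing to pay. -/
theorem iInf_expectedSocialCost_zero {T E : Type*} (Γ : BayesianNetworkDesignGame 0 T E)
    (β : ℝ≥0∞) :
    (⨅ s : {s : Fin 0 → T → Finset E // Γ.IsStrategyProfile s}, Γ.expectedSocialCost s.1) ≤
      β * Γ.expectedOptCost := by
  refine (iInf_le _ ⟨fun i => i.elim0, fun i => i.elim0⟩).trans ?_
  simp [expectedSocialCost, expect, socialCost]

end Equilibrium

end BayesianNetworkDesignGame

/-! ### The local-ratio algorithm for cover games. -/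

namespace CoverPrimalDual

variable {V T : Type*} [DecidableEq V]

/-- The residual costs after uniformly lowering the costs on `h` until some node of `h` is free. -/
noncomputable def lower (h : T → Finset V) (hh : ∀ t, (h t).Nonempty) (w : V → ℝ) (t : T) : V → ℝ :=
  fun v => if v ∈ h t then w v - (h t).inf' (hh t) w else w v

/-- The residual costs after processing a sequence of types. -/
noncomputable def residual (h : T → Finset V) (hh : ∀ t, (h t).Nonempty) (c : V → ℝ) :
    (m : ℕ) → (Fin m → T) → V → ℝ
  | 0, _ => c
  | m + 1, X => lower h hh (residual h hh c m (Fin.init X)) (X (Fin.last m))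

variable {h : T → Finset V} {hh : ∀ t, (h t).Nonempty} {c : V → ℝ}

theorem lower_nonneg {w : V → ℝ} (hw : ∀ v, 0 ≤ w v) (t : T) (v : V) : 0 ≤ lower h hh w t v := by
  unfold lower
  split_ifs with hv
  · exact sub_nonneg.2 (Finset.inf'_le _ hv)
  · exact hw v

theorem lower_le {w : V → ℝ} (hw : ∀ v, 0 ≤ w v) (t : T) (v : V) : lower h hh w t v ≤ w v := by
  unfold lower
  split_ifs with hv
  · exact sub_le_self _ (Finset.le_inf' _ _ fun v _ => hw v)
  · exact le_rfl

theorem residual_nonneg (hc : ∀ v, 0 ≤ c v) (m : ℕ) (X : Fin m → T) (v : V) :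
    0 ≤ residual h hh c m X v := by
  induction m generalizing v with
  | zero => exact hc v
  | succ m ih => exact lower_nonneg (fun v => ih _ v) _ _

/-- A step that lowers the costs on a type by μ removes at most d μ in total. It removes at least μ
from `U`, because `U` meets the type. -/
theorem sum_residual [Fintype V] (hc : ∀ v, 0 ≤ c v) {d : ℕ} (hd : ∀ t, (h t).card ≤ d)
    (U : Finset V) (m : ℕ) (X : Fin m → T) (hU : ∀ i, ∃ v ∈ h (X i), v ∈ U) :
    ∑ v, (c v - residual h hh c m X v) ≤ d * ∑ v ∈ U, (c v - residual h hh c m X v) := by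
  induction m with
  | zero => simp [residual]
  | succ m ih =>
    have ih' := ih (Fin.init X) fun i => hU i.castSucc
    set w := residual h hh c m (Fin.init X) with hw
    set t := X (Fin.last m)
    set μ := (h t).inf' (hh t) w with hμ
    have hμ0 : 0 ≤ μ := Finset.le_inf' _ _ fun v _ => residual_nonneg hc _ _ v
    have key : ∀ v, c v - residual h hh c (m + 1) X v =
        (c v - w v) + if v ∈ h t then μ else 0 := by
      intro v
      simp only [residual, lower]
      split_ifs <;> ring
    simp only [key, Finset.sum_add_distrib, mul_add]
    refine add_le_add ih' ?_
    obtain ⟨v, hv, hvU⟩ := hU (Fin.last m)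
    have h1 : ∑ v, (if v ∈ h t then μ else 0) = (h t).card * μ := by
      rw [← Finset.sum_filter]; simp
    have h2 : μ ≤ ∑ v ∈ U, (if v ∈ h t then μ else 0) := by
      refine le_trans (le_of_eq ?_) (Finset.single_le_sum (f := fun v => if v ∈ h t then μ else 0)
        (fun v _ => by split_ifs <;> simp [hμ0]) hvU)
      rw [if_pos hv]
    rw [h1]
    refine mul_le_mul (by exact_mod_cast hd t) h2 hμ0 (by positivity)

/-- The nodes whose cost is completely paid for. -/
noncomputable def tight [Fintype V] (h : T → Finset V) (hh : ∀ t, (h t).Nonempty) (c : V → ℝ)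
    {m : ℕ} (X : Fin m → T) : Finset V :=
  Finset.univ.filter fun v => residual h hh c m X v = 0

/-- Reductions pay for tight nodes in full, and the reductions on `U` do not exceed its cost. -/
theorem cost_tight_le [Fintype V] (hc : ∀ v, 0 ≤ c v) {d : ℕ} (hd : ∀ t, (h t).card ≤ d)
    (U : Finset V) {m : ℕ} (X : Fin m → T) (hU : ∀ i, ∃ v ∈ h (X i), v ∈ U) :
    ∑ v ∈ tight h hh c X, c v ≤ d * ∑ v ∈ U, c v := by
  have hle : ∀ v, residual h hh c m X v ≤ c v := by
    intro v
    clear hU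
    induction m with
    | zero => exact le_rfl
    | succ m ih => exact (lower_le (fun v => residual_nonneg hc _ _ v) _ _).trans (ih _)
  calc ∑ v ∈ tight h hh c X, c v = ∑ v ∈ tight h hh c X, (c v - residual h hh c m X v) :=
        Finset.sum_congr rfl fun v hv => by rw [(Finset.mem_filter.1 hv).2, sub_zero]
    _ ≤ ∑ v, (c v - residual h hh c m X v) :=
        Finset.sum_le_sum_of_subset_of_nonneg (Finset.subset_univ _) fun v _ _ =>
          sub_nonneg.2 (hle v)
    _ ≤ d * ∑ v ∈ U, (c v - residual h hh c m X v) := sum_residual hc hd U m X hU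
    _ ≤ _ := by
        gcongr with v
        exact sub_le_self _ (residual_nonneg hc _ _ v)

theorem tight_init_subset [Fintype V] (hc : ∀ v, 0 ≤ c v) {m : ℕ} (X : Fin (m + 1) → T) :
    tight h hh c (Fin.init X : Fin m → T) ⊆ tight h hh c X := by
  intro v hv
  rw [tight, Finset.mem_filter] at hv ⊢
  exact ⟨hv.1, le_antisymm ((lower_le (fun v => residual_nonneg hc _ _ v) _ _).trans hv.2.le)
    (residual_nonneg hc _ _ v)⟩

/-- The cost for type `t` of augmenting `B` by the cheapest node of `h t`. -/
noncomputable def augmentCost (h : T → Finset V) (hh : ∀ t, (h t).Nonempty) (c : V → ℝ)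
    (B : Finset V) (t : T) : ℝ :=
  if Disjoint (h t) B then (h t).inf' (hh t) c else 0

theorem augmentCost_anti (hc : ∀ v, 0 ≤ c v) {B B' : Finset V} (hB : B ⊆ B') (t : T) :
    augmentCost h hh c B' t ≤ augmentCost h hh c B t := by
  have h0 : 0 ≤ (h t).inf' (hh t) c := Finset.le_inf' _ _ fun v _ => hc v
  unfold augmentCost
  by_cases h1 : Disjoint (h t) B'
  · rw [if_pos h1, if_pos (h1.mono_right hB)]
  · rw [if_neg h1]; split_ifs <;> simp [h0]

/-- If the last type misses the tight set, processing it makes one of its nodes newly tight, and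
that node costs at least as much as the cheapest one. -/
theorem augmentCost_init [Fintype V] (hc : ∀ v, 0 ≤ c v) {m : ℕ} (X : Fin (m + 1) → T) :
    augmentCost h hh c (tight h hh c (Fin.init X : Fin m → T)) (X (Fin.last m)) +
      ∑ v ∈ tight h hh c (Fin.init X : Fin m → T), c v ≤ ∑ v ∈ tight h hh c X, c v := by
  unfold augmentCost
  split_ifs with hd
  · obtain ⟨v, hv, hmin⟩ := Finset.exists_mem_eq_inf' (hh (X (Fin.last m)))
      (residual h hh c m (Fin.init X))
    have hnot : v ∉ tight h hh c (Fin.init X : Fin m → T) := Finset.disjoint_left.1 hd hv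
    have hmem : v ∈ tight h hh c X := by
      rw [tight, Finset.mem_filter]
      refine ⟨Finset.mem_univ _, ?_⟩
      change lower _ _ _ _ _ = 0
      rw [lower, if_pos hv, hmin, sub_self]
    calc _ ≤ c v + ∑ v ∈ tight h hh c (Fin.init X : Fin m → T), c v := by
          gcongr; exact Finset.inf'_le _ hv
      _ = ∑ v ∈ insert v (tight h hh c (Fin.init X : Fin m → T)), c v := by
          rw [Finset.sum_insert hnot]
      _ ≤ _ := Finset.sum_le_sum_of_subset_of_nonneg
          (Finset.insert_subset hmem (tight_init_subset hc X)) fun v _ _ => hc v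
  · rw [zero_add]
    exact Finset.sum_le_sum_of_subset_of_nonneg (tight_init_subset hc X) fun v _ _ => hc v

/-- The tight set telescopes as the last type is peeled off. For every other held-out type, dropping
the last type from its sample shrinks the tight set and can only raise its augmentation cost. -/
theorem sum_augmentCost_le [Fintype V] (hc : ∀ v, 0 ≤ c v) {m : ℕ} (X : Fin (m + 1) → T) :
    ∑ j : Fin (m + 1), augmentCost h hh c (tight h hh c (j.removeNth X : Fin m → T)) (X j) ≤
      ∑ v ∈ tight h hh c X, c v := by
  have hlast : ∀ {m : ℕ} (X : Fin (m + 1) → T),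
      (Fin.last m).removeNth X = (Fin.init X : Fin m → T) := fun X => by
    ext i; simp [Fin.removeNth, Fin.init]
  induction m with
  | zero =>
    rw [Fin.sum_univ_castSucc]
    simp only [Finset.univ_eq_empty, Finset.sum_empty, zero_add]
    have h1 := augmentCost_init (hh := hh) hc X
    have h2 : 0 ≤ ∑ v ∈ tight h hh c (Fin.init X : Fin 0 → T), c v :=
      Finset.sum_nonneg fun v _ => hc v
    rw [hlast]; linarith
  | succ m ih =>
    rw [Fin.sum_univ_castSucc, hlast]
    have h1 := augmentCost_init (hh := hh) hc X
    refine le_trans (add_le_add_left ?_ _) (by rwa [add_comm] at h1)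
    refine le_trans (Finset.sum_le_sum fun j _ => ?_) (ih (Fin.init X))
    have h2 : j.removeNth (Fin.init X : Fin (m + 1) → T) =
        (Fin.init (j.castSucc.removeNth X : Fin (m + 1) → T) : Fin m → T) := by
      ext i
      simp [Fin.removeNth, Fin.init, Fin.castSucc_succAbove_castSucc]
    rw [h2]
    exact augmentCost_anti hc (tight_init_subset hc _) _

end CoverPrimalDual

open CoverPrimalDual in
open Classical in
/-- Cover games, in which a type is a nonempty set of at most `d` nodes. -/
theorem iInf_expectedSocialCost_cover_le {V T : Type*} [Finite V] [Finite T] {n : ℕ}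
    (Γ : BayesianNetworkDesignGame n T V) {ρ : PMF T} (hρ : ∀ i, Γ.prior i = ρ)
    (h : T → Finset V) (hh : ∀ t, (h t).Nonempty) {d : ℕ} (hd : ∀ t, (h t).card ≤ d)
    (hfeas : ∀ i t, Γ.feasible i t = {a | ∃ v ∈ h t, a = {v}}) (β : ℝ≥0) (hβ : β ≠ 0)
    (hdβ : 2 * (d : ℝ≥0) ≤ β) :
    (⨅ s : {s : Fin n → T → Finset V // Γ.IsStrategyProfile s}, Γ.expectedSocialCost s.1) ≤
      β * Γ.expectedOptCost := by
  have := Fintype.ofFinite V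
  obtain _ | m := n
  · exact Γ.iInf_expectedSocialCost_zero β
  let c : V → ℝ := fun v => Γ.elementCost v
  have hc : ∀ v, 0 ≤ c v := fun v => (Γ.elementCost v).2
  have hcost : ∀ S, ((Γ.cost S : ℝ≥0) : ℝ) = ∑ v ∈ S, c v := fun S => by
    simp [BayesianNetworkDesignGame.cost, c]
  have hchoice : ∀ (B : Finset V) (t : T), ∃ v ∈ h t,
      ((Γ.cost ({v} \ B) : ℝ≥0) : ℝ) ≤ augmentCost h hh c B t := by
    intro B t
    by_cases hdis : Disjoint (h t) B
    · obtain ⟨v, hv, hmin⟩ := Finset.exists_mem_eq_inf' (hh t) c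
      refine ⟨v, hv, ?_⟩
      rw [augmentCost, if_pos hdis, hmin]
      have : ({v} : Finset V) \ B = {v} := by simpa using Finset.disjoint_left.1 hdis hv
      rw [this, hcost]; simp
    · obtain ⟨v, hv, hvB⟩ := Finset.not_disjoint_iff.1 hdis
      refine ⟨v, hv, ?_⟩
      rw [augmentCost, if_neg hdis]
      have : ({v} : Finset V) \ B = ∅ := by simpa using hvB
      rw [this, hcost]; simp
  choose pick hpick hpick' using hchoice
  refine Γ.iInf_expectedSocialCost_le_of_sampling hρ (fun Y => tight h hh c Y)
    (fun Y t => {pick (tight h hh c Y) t}) (fun Y t i => ?_) β hβ fun X a ha => ?_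
  · rw [hfeas]; exact ⟨_, hpick _ _, rfl⟩
  have hU : ∀ i, ∃ v ∈ h (X i), v ∈ Finset.univ.biUnion a := by
    intro i
    have := ha i
    rw [hfeas] at this
    obtain ⟨v, hv, hav⟩ := this
    exact ⟨v, hv, Finset.mem_biUnion.2 ⟨i, Finset.mem_univ _, by simp [hav]⟩⟩
  rw [← NNReal.coe_le_coe]
  push_cast
  have h1 : ∑ j : Fin (m + 1), ((Γ.cost (tight h hh c (j.removeNth X : Fin m → T)) : ℝ≥0) : ℝ) ≤
      (m + 1) * (d * ((Γ.cost (Finset.univ.biUnion a) : ℝ≥0) : ℝ)) := by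
    refine (Finset.sum_le_card_nsmul _ _ (d * ((Γ.cost (Finset.univ.biUnion a) : ℝ≥0) : ℝ))
      fun j _ => ?_).trans (by simp)
    rw [hcost, hcost]
    exact cost_tight_le hc hd _ _ fun i => hU _
  have h2 : ∑ j : Fin (m + 1), ((Γ.cost ({pick (tight h hh c (j.removeNth X : Fin m → T)) (X j)} \
      tight h hh c (j.removeNth X : Fin m → T)) : ℝ≥0) : ℝ) ≤
      d * ((Γ.cost (Finset.univ.biUnion a) : ℝ≥0) : ℝ) := by
    refine (Finset.sum_le_sum fun j _ => hpick' _ _).trans ((sum_augmentCost_le hc X).trans ?_)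
    rw [hcost]
    exact cost_tight_le hc hd _ _ hU
  have h3 : 2 * (d : ℝ) ≤ β := by exact_mod_cast hdβ
  have h4 : (0 : ℝ) ≤ (Γ.cost (Finset.univ.biUnion a) : ℝ≥0) := NNReal.coe_nonneg _
  -- The solution and the augmentations contribute a factor `d` each.
  calc _ ≤ (m + 1) * (d * ((Γ.cost (Finset.univ.biUnion a) : ℝ≥0) : ℝ)) +
        ((m : ℝ) + 1) * (d * ((Γ.cost (Finset.univ.biUnion a) : ℝ≥0) : ℝ)) := by gcongr
    _ = ((m : ℝ) + 1) * (2 * d * ((Γ.cost (Finset.univ.biUnion a) : ℝ≥0) : ℝ)) := by ring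
    _ ≤ _ := by gcongr

theorem iInf_expectedSocialCost_hypergraphCoverGame_le {V : Type*} [Finite V] {d : ℕ}
    (hd : 1 ≤ d) (c : V → ℝ≥0) (n : ℕ) (ρ : PMF {h : Finset V // h.card = d}) :
    (⨅ s : {s // (hypergraphCoverGame d c (fun _ : Fin n => ρ)).IsStrategyProfile s},
      (hypergraphCoverGame d c (fun _ : Fin n => ρ)).expectedSocialCost s.1) ≤
      (2 * (d + 1 : ℝ≥0) : ℝ≥0) * (hypergraphCoverGame d c (fun _ : Fin n => ρ)).expectedOptCost :=
  iInf_expectedSocialCost_cover_le (hypergraphCoverGame d c (fun _ : Fin n => ρ)) (fun _ => rfl)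
    (fun t => t.1) (fun t => Finset.card_pos.1 (by rw [t.2]; omega)) (fun t => t.2.le)
    (fun _ _ => rfl) _ (by positivity) (by gcongr; simp)

-- A pair may repeat a node, so the type sets have at most 2 elements; the general argument already
-- gives the factor 4.
open Classical in
theorem iInf_expectedSocialCost_vertexCoverGame_le {V : Type*} [Finite V]
    (c : V → ℝ≥0) (n : ℕ) (ρ : PMF (V × V)) :
    (⨅ s : {s // (vertexCoverGame c (fun _ : Fin n => ρ)).IsStrategyProfile s},
      (vertexCoverGame c (fun _ : Fin n => ρ)).expectedSocialCost s.1) ≤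
      (6 : ℝ≥0) * (vertexCoverGame c (fun _ : Fin n => ρ)).expectedOptCost :=
  iInf_expectedSocialCost_cover_le (vertexCoverGame c (fun _ : Fin n => ρ)) (fun _ => rfl)
    (fun t => {t.1, t.2}) (fun t => by simp) (d := 2) (fun t => Finset.card_le_two)
    (fun _ t => by ext a; simp [vertexCoverGame]) _ (by norm_num) (by norm_num)

/-! ### Pseudometrics and connectivity by sets of virtual edges. -/

/-- A pseudo-metric, as a bare real-valued function. -/
structure IsPseudoDist {V : Type*} (d : V → V → ℝ) : Prop where
  refl : ∀ x, d x x = 0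
  symm : ∀ x y, d x y = d y x
  tri : ∀ x y z, d x z ≤ d x y + d y z

theorem IsPseudoDist.nonneg {V : Type*} {d : V → V → ℝ} (hd : IsPseudoDist d) (x y : V) :
    0 ≤ d x y := by
  have h1 := hd.tri x y x
  rw [hd.refl, hd.symm y x] at h1
  linarith

/-- `x` and `y` are connected by the edges in `A`. -/
def Conn {V : Type*} (A : Finset (V × V)) (x y : V) : Prop :=
  ∀ P : V → Prop, (∀ e ∈ A, P e.1 ↔ P e.2) → (P x ↔ P y)

namespace Conn

variable {V : Type*} {A B : Finset (V × V)} {x y z : V}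

theorem refl (A : Finset (V × V)) (x : V) : Conn A x x := fun _ _ => Iff.rfl

theorem symm (h : Conn A x y) : Conn A y x := fun P hP => (h P hP).symm

theorem trans (h : Conn A x y) (h' : Conn A y z) : Conn A x z :=
  fun P hP => (h P hP).trans (h' P hP)

theorem of_mem {e : V × V} (h : e ∈ A) : Conn A e.1 e.2 := fun _ hP => hP e h

/-- Connectivity is monotone in the edges, each of which may be replaced by a connection. -/
theorem of_forall (hAB : ∀ e ∈ A, Conn B e.1 e.2) (h : Conn A x y) : Conn B x y :=
  fun P hP => h P fun e he => hAB e he P hP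

theorem mono (hAB : A ⊆ B) (h : Conn A x y) : Conn B x y :=
  of_forall (fun _ he => of_mem (hAB he)) h

end Conn

/-- The total weight of a set of edges. -/
noncomputable def weight {V : Type*} (d : V → V → ℝ) (A : Finset (V × V)) : ℝ :=
  ∑ e ∈ A, d e.1 e.2

section Weight

variable {V : Type*} {d : V → V → ℝ}

theorem weight_nonneg (hd : IsPseudoDist d) (A : Finset (V × V)) : 0 ≤ weight d A :=
  Finset.sum_nonneg fun _ _ => hd.nonneg _ _

theorem weight_mono (hd : IsPseudoDist d) {A B : Finset (V × V)} (h : A ⊆ B) : weight d A ≤ weight d B :=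
  Finset.sum_le_sum_of_subset_of_nonneg h fun _ _ _ => hd.nonneg _ _

theorem weight_union_le [DecidableEq V] (hd : IsPseudoDist d) (A B : Finset (V × V)) : weight d (A ∪ B) ≤ weight d A + weight d B := by
  rw [weight, weight, weight, ← Finset.sum_union_inter]
  have : 0 ≤ ∑ e ∈ A ∩ B, d e.1 e.2 := weight_nonneg hd _
  linarith

end Weight

/-! ### Passing between graph edges and virtual edges weighted by path distance. -/

namespace ShortestPath

variable {V : Type*} {G : SimpleGraph V} {c : G.edgeSet → ℝ≥0}

/-- `x` and `y` are joined by a walk in `S`, or `S` consists of all edges. -/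
def Linked (S : Finset G.edgeSet) (x y : V) : Prop :=
  (∃ p : G.Walk x y, ∀ e ∈ p.edges, ∃ e' ∈ S, (e' : Sym2 V) = e) ∨ ∀ e, e ∈ S

theorem Linked.refl (S : Finset G.edgeSet) (x : V) : Linked S x x :=
  Or.inl ⟨.nil, by simp⟩

theorem Linked.symm {S : Finset G.edgeSet} {x y : V} (h : Linked S x y) : Linked S y x := by
  obtain ⟨p, hp⟩ | h := h
  · exact Or.inl ⟨p.reverse, fun e he => hp e (by simpa using he)⟩
  · exact Or.inr h

theorem Linked.mono {S S' : Finset G.edgeSet} (hS : S ⊆ S') {x y : V} (h : Linked S x y) :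
    Linked S' x y := by
  obtain ⟨p, hp⟩ | h := h
  · exact Or.inl ⟨p, fun e he => (hp e he).imp fun e' h' => ⟨hS h'.1, h'.2⟩⟩
  · exact Or.inr fun e => hS (h e)

theorem Linked.trans {S : Finset G.edgeSet} {x y z : V} (h : Linked S x y) (h' : Linked S y z) :
    Linked S x z := by
  obtain ⟨p, hp⟩ | h := h
  · obtain ⟨q, hq⟩ | h' := h'
    · refine Or.inl ⟨p.append q, fun e he => ?_⟩
      rw [SimpleGraph.Walk.edges_append, List.mem_append] at he
      exact he.elim (hp e) (hq e)
    · exact Or.inr h'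
  · exact Or.inr h

/-- A connection between reachable nodes contains a path. -/
theorem Linked.exists_path [Finite V] {S : Finset G.edgeSet} {x y : V} (h : Linked S x y)
    (hr : G.Reachable x y) : ∃ a ∈ pathEdgeSets G x y, a ⊆ S := by
  classical
  have := Fintype.ofFinite V
  have := Fintype.ofFinite G.edgeSet
  have h' : ∃ p : G.Walk x y, ∀ e ∈ p.edges, ∃ e' ∈ S, (e' : Sym2 V) = e := by
    obtain h | h := h
    · exact h
    · obtain ⟨p⟩ := hr
      exact ⟨p, fun e he => ⟨⟨e, p.edges_subset_edgeSet he⟩, h _, rfl⟩⟩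
  obtain ⟨p, hp⟩ := h'
  refine ⟨Finset.univ.filter fun e => (e : Sym2 V) ∈ p.bypass.edges,
    ⟨p.bypass, p.bypass_isPath, fun e => by simp⟩, fun e he => ?_⟩
  obtain ⟨e', he', heq⟩ := hp e (p.edges_bypass_subset_edges (Finset.mem_filter.1 he).2)
  rwa [← Subtype.ext heq]

-- The second alternative in `Linked` lets the full edge set link any two nodes, so that distances
-- are finite even between different components of `G`.
open Classical in
theorem exists_connector [Finite V] (c : G.edgeSet → ℝ≥0) (x y : V) :
    ∃ S : Finset G.edgeSet, Linked S x y ∧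
      ∀ S', Linked S' x y → ∑ e ∈ S, c e ≤ ∑ e ∈ S', c e := by
  have := Fintype.ofFinite G.edgeSet
  obtain ⟨S, h1, h2⟩ := Set.exists_min_image {S : Finset G.edgeSet | Linked S x y}
    (fun S => ∑ e ∈ S, c e) (Set.toFinite _) ⟨Finset.univ, Or.inr fun e => Finset.mem_univ e⟩
  exact ⟨S, h1, h2⟩

/-- A cheapest set of edges that links `x` and `y`. -/
noncomputable def connector [Finite V] (c : G.edgeSet → ℝ≥0) (x y : V) : Finset G.edgeSet :=
  (exists_connector c x y).choose

theorem linked_connector [Finite V] (c : G.edgeSet → ℝ≥0) (x y : V) :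
    Linked (connector c x y) x y := (exists_connector c x y).choose_spec.1

/-- The shortest path distance. -/
noncomputable def pathDist [Finite V] (c : G.edgeSet → ℝ≥0) (x y : V) : ℝ :=
  (∑ e ∈ connector c x y, c e : ℝ≥0)

theorem pathDist_le [Finite V] {S : Finset G.edgeSet} {x y : V} (h : Linked S x y) :
    pathDist c x y ≤ (∑ e ∈ S, c e : ℝ≥0) :=
  NNReal.coe_le_coe.2 ((exists_connector c x y).choose_spec.2 S h)

open Classical in
theorem pathDist_triangle [Finite V] (c : G.edgeSet → ℝ≥0) (x y z : V) :
    pathDist c x z ≤ pathDist c x y + pathDist c y z := by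
  have h : Linked (connector c x y ∪ connector c y z) x z :=
    ((linked_connector c x y).mono Finset.subset_union_left).trans
      ((linked_connector c y z).mono Finset.subset_union_right)
  refine (pathDist_le h).trans ?_
  rw [pathDist, pathDist, ← NNReal.coe_add, NNReal.coe_le_coe, ← Finset.sum_union_inter]
  exact le_self_add

theorem isPseudoDist_pathDist [Finite V] (c : G.edgeSet → ℝ≥0) : IsPseudoDist (pathDist c) where
  refl x := le_antisymm ((pathDist_le (Linked.refl ∅ x)).trans (by simp)) (NNReal.coe_nonneg _)
  symm x y := le_antisymm (pathDist_le (linked_connector c y x).symm)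
    (pathDist_le (linked_connector c x y).symm)
  tri := pathDist_triangle c

open Classical in
/-- The graph edges that realise a set of virtual edges. -/
noncomputable def realise [Finite V] (c : G.edgeSet → ℝ≥0) (A : Finset (V × V)) :
    Finset G.edgeSet :=
  A.biUnion fun e => connector c e.1 e.2

/-- Being linked to `x` is a predicate preserved along the edges of `A`, so `Conn` applies to it. -/
theorem linked_realise [Finite V] {A : Finset (V × V)} {x y : V} (h : Conn A x y) :
    Linked (realise c A) x y := by
  refine (h (fun z => Linked (realise c A) x z) fun e he => ?_).1 (Linked.refl _ _)
  have : Linked (realise c A) e.1 e.2 := (linked_connector c e.1 e.2).mono fun e' he' => by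
    simp only [realise, Finset.mem_biUnion]
    exact ⟨e, he, he'⟩
  exact ⟨fun h => h.trans this, fun h => h.trans this.symm⟩

open Classical in
/-- The virtual edges of a set of graph edges. -/
noncomputable def virtual (S : Finset G.edgeSet) : Finset (V × V) :=
  S.image fun e : G.edgeSet => Quot.out e.1

theorem weight_virtual_le [Finite V] (S : Finset G.edgeSet) :
    weight (pathDist c) (virtual S) ≤ (∑ e ∈ S, c e : ℝ≥0) := by
  classical
  rw [weight, virtual]
  refine (Finset.sum_image_le_of_nonneg (f := fun e : V × V => pathDist c e.1 e.2)
    (fun _ _ => (isPseudoDist_pathDist c).nonneg _ _)).trans ?_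
  rw [NNReal.coe_sum]
  refine Finset.sum_le_sum fun e _ => ?_
  have he : s((e : Sym2 V).out.1, (e : Sym2 V).out.2) = (e : Sym2 V) :=
    Quot.out_eq (e : Sym2 V)
  have hadj : G.Adj (e : Sym2 V).out.1 (e : Sym2 V).out.2 := by
    rw [← SimpleGraph.mem_edgeSet, he]; exact e.2
  refine (pathDist_le (S := {e}) (Or.inl ⟨hadj.toWalk, fun e' he' => ⟨e, by simp, ?_⟩⟩)).trans
    (by simp)
  simp only [SimpleGraph.Adj.toWalk, SimpleGraph.Walk.edges_cons, SimpleGraph.Walk.edges_nil, List.mem_singleton] at he'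
  rw [he', he]

theorem conn_virtual {S : Finset G.edgeSet} {x y : V} {a : Finset G.edgeSet}
    (ha : a ∈ pathEdgeSets G x y) (haS : a ⊆ S) : Conn (virtual S) x y := by
  classical
  obtain ⟨p, -, hp⟩ := ha
  have h : ∀ e ∈ p.edges, ∃ e' ∈ S, (e' : Sym2 V) = e := fun e he =>
    ⟨⟨e, p.edges_subset_edgeSet he⟩, haS ((hp _).2 he), rfl⟩
  clear hp
  induction p with
  | nil => exact Conn.refl _ _
  | @cons u v w hadj p ih =>
    refine Conn.trans ?_ (ih fun e he => h e (by simp [he]))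
    obtain ⟨e', he', heq⟩ := h s(u, v) (by simp)
    have hmem : (e' : Sym2 V).out ∈ virtual S :=
      Finset.mem_image_of_mem (fun e : G.edgeSet => Quot.out e.1) he'
    have hout : s((e' : Sym2 V).out.1, (e' : Sym2 V).out.2) = s(u, v) := by
      rw [← heq]; exact Quot.out_eq (e' : Sym2 V)
    have hc := Conn.of_mem hmem
    rcases Sym2.eq_iff.1 hout with ⟨h1, h2⟩ | ⟨h1, h2⟩
    · rwa [h1, h2] at hc
    · rw [h1, h2] at hc; exact hc.symm

end ShortestPath

open ShortestPath

/-- Network games: a sampling rule that is stated in terms of virtual edges. -/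
theorem iInf_expectedSocialCost_network_le {V T : Type*} [Finite V] [DecidableEq V] [Finite T] {m : ℕ}
    {G : SimpleGraph V} (Γ : BayesianNetworkDesignGame (m + 1) T G.edgeSet) {ρ : PMF T}
    (hρ : ∀ i, Γ.prior i = ρ) (p : T → V × V) (hr : ∀ t, G.Reachable (p t).1 (p t).2)
    (hfeas : ∀ i t, Γ.feasible i t = pathEdgeSets G (p t).1 (p t).2)
    (F : (Fin m → T) → Finset (V × V)) (B : (Fin m → T) → T → Finset (V × V))
    (hconn : ∀ Y t, Conn (F Y ∪ B Y t) (p t).1 (p t).2) (β : ℝ≥0) (hβ : β ≠ 0)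
    (H : ∀ (X : Fin (m + 1) → T) (A : Finset (V × V)), (∀ i, Conn A (p (X i)).1 (p (X i)).2) →
      ∑ j : Fin (m + 1), weight (pathDist Γ.elementCost) (F (j.removeNth X)) +
        (m + 1) * ∑ j : Fin (m + 1), weight (pathDist Γ.elementCost) (B (j.removeNth X) (X j)) ≤
      (m + 1) * (β * weight (pathDist Γ.elementCost) A)) :
    (⨅ s : {s : Fin (m + 1) → T → Finset G.edgeSet // Γ.IsStrategyProfile s},
      Γ.expectedSocialCost s.1) ≤ β * Γ.expectedOptCost := by
  have hreal : ∀ A : Finset (V × V), ((Γ.cost (realise Γ.elementCost A) : ℝ≥0) : ℝ) ≤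
      weight (pathDist Γ.elementCost) A := by
    intro A
    have h := NNReal.coe_le_coe.2 (Γ.cost_biUnion_le A fun e => connector Γ.elementCost e.1 e.2)
    rw [NNReal.coe_sum] at h
    unfold realise weight
    convert h
    rfl
  have hs : ∀ Y t, ∃ a ∈ pathEdgeSets G (p t).1 (p t).2,
      a ⊆ realise Γ.elementCost (F Y) ∪ realise Γ.elementCost (B Y t) := by
    intro Y t
    obtain ⟨a, ha, h⟩ := (linked_realise (c := Γ.elementCost) (hconn Y t)).exists_path (hr t)
    refine ⟨a, ha, fun e he => ?_⟩
    have h1 := h he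
    simp only [realise, Finset.mem_biUnion, Finset.mem_union] at h1 ⊢
    obtain ⟨f, hf | hf, hef⟩ := h1
    · exact Or.inl ⟨f, hf, hef⟩
    · exact Or.inr ⟨f, hf, hef⟩
  choose s hs hsub using hs
  refine Γ.iInf_expectedSocialCost_le_of_sampling hρ (fun Y => realise Γ.elementCost (F Y)) s
    (fun Y t i => by rw [hfeas]; exact hs Y t) β hβ fun X a ha => ?_
  -- An arbitrary feasible profile is turned into virtual edges, whose weight is at most its cost.
  have hA := H X (virtual (Finset.univ.biUnion a)) fun i => by
    have := ha i
    rw [hfeas] at this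
    exact conn_virtual this (Finset.subset_biUnion_of_mem a (Finset.mem_univ i))
  have hU : weight (pathDist Γ.elementCost) (virtual (Finset.univ.biUnion a)) ≤
      (Γ.cost (Finset.univ.biUnion a) : ℝ≥0) := weight_virtual_le _
  rw [← NNReal.coe_le_coe]
  push_cast
  calc _ ≤ ∑ j : Fin (m + 1), weight (pathDist Γ.elementCost) (F (j.removeNth X)) +
        ((m : ℝ) + 1) * ∑ j : Fin (m + 1),
          weight (pathDist Γ.elementCost) (B (j.removeNth X) (X j)) := by
        gcongr with j _ j _
        · exact hreal _
        · refine le_trans (NNReal.coe_le_coe.2 (Γ.cost_mono ?_)) (hreal _)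
          intro e he
          simp only [Finset.mem_sdiff] at he
          have h := hsub _ _ he.1
          simp only [Finset.mem_union] at h
          exact h.resolve_left he.2
    _ ≤ _ := hA
    _ ≤ _ := by gcongr; exact hU.trans (le_of_eq (by congr; exact Subsingleton.elim _ _))

/-! ### From cuts to potentials by integration over level sets. -/

section LayerCake

/-- The indicator of `τ < a`. -/
noncomputable def above (a τ : ℝ) : ℝ := if τ < a then 1 else 0

theorem antitone_above (a : ℝ) : Antitone (above a) := by
  intro x y hxy
  unfold above
  split_ifs <;> linarith

theorem above_mono {a b : ℝ} (hab : a ≤ b) (τ : ℝ) : above a τ ≤ above b τ := by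
  unfold above
  split_ifs <;> linarith

theorem integral_above {a M : ℝ} (h0 : 0 ≤ a) (hM : a ≤ M) : ∫ τ in (0 : ℝ)..M, above a τ = a := by
  have hint : ∀ x y, IntervalIntegrable (above a) MeasureTheory.volume x y := fun x y =>
    (antitone_above a).intervalIntegrable
  rw [← intervalIntegral.integral_add_adjacent_intervals (hint 0 a) (hint a M)]
  have h1 : ∫ τ in (0 : ℝ)..a, above a τ = ∫ _τ in (0 : ℝ)..a, (1 : ℝ) := by
    refine intervalIntegral.integral_congr_ae ?_
    have : ∀ᵐ τ : ℝ, τ ≠ a := by simp [MeasureTheory.ae_iff]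
    filter_upwards [this] with τ hτ h
    rw [Set.uIoc_of_le h0] at h
    rw [above, if_pos (lt_of_le_of_ne h.2 hτ)]
  have h2 : ∫ τ in a..M, above a τ = ∫ _τ in a..M, (0 : ℝ) := by
    refine intervalIntegral.integral_congr fun τ h => ?_
    rw [Set.uIcc_of_le hM] at h
    simp only [above]
    rw [if_neg (not_lt.2 h.1)]
  rw [h1, h2]
  simp

theorem abs_above_sub_above {a b : ℝ} (hab : a ≤ b) (τ : ℝ) :
    |above a τ - above b τ| = above b τ - above a τ := by
  rw [abs_sub_comm, abs_of_nonneg (sub_nonneg.2 (above_mono hab τ))]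

theorem integral_abs_above {a b M : ℝ} (ha0 : 0 ≤ a) (haM : a ≤ M) (hb0 : 0 ≤ b) (hbM : b ≤ M) :
    IntervalIntegrable (fun τ => |above a τ - above b τ|) MeasureTheory.volume 0 M ∧
      ∫ τ in (0 : ℝ)..M, |above a τ - above b τ| = |a - b| := by
  have hint : ∀ a, IntervalIntegrable (above a) MeasureTheory.volume 0 M := fun a =>
    (antitone_above a).intervalIntegrable
  refine ⟨((hint a).sub (hint b)).abs, ?_⟩
  rcases le_total a b with hab | hab
  · simp only [abs_above_sub_above hab]
    rw [intervalIntegral.integral_sub (hint b) (hint a), integral_above ha0 haM,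
      integral_above hb0 hbM, abs_sub_comm, abs_of_nonneg (sub_nonneg.2 hab)]
  · simp only [abs_sub_comm (above a _), abs_above_sub_above hab]
    rw [intervalIntegral.integral_sub (hint a) (hint b), integral_above ha0 haM,
      integral_above hb0 hbM, abs_of_nonneg (sub_nonneg.2 hab)]

/-- A linear inequality that holds for all level sets holds for the function. -/
theorem sum_le_sum_of_level {ι κ : Type*} (E : Finset ι) (K : Finset κ) (α u v : ι → ℝ)
    (γ w : κ → ℝ) {M : ℝ} (hM : 0 ≤ M) (hu : ∀ e, 0 ≤ u e ∧ u e ≤ M) (hv : ∀ e, 0 ≤ v e ∧ v e ≤ M)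
    (hw : ∀ k, 0 ≤ w k ∧ w k ≤ M)
    (h : ∀ τ, 0 ≤ τ → ∑ k ∈ K, γ k * above (w k) τ ≤
      ∑ e ∈ E, α e * |above (u e) τ - above (v e) τ|) :
    ∑ k ∈ K, γ k * w k ≤ ∑ e ∈ E, α e * |u e - v e| := by
  -- A value in [0, M] is the integral of its level indicators, so the hypothesis only has to be
  -- integrated over the threshold.
  have h1 : ∑ k ∈ K, γ k * w k = ∫ τ in (0 : ℝ)..M, ∑ k ∈ K, γ k * above (w k) τ := by
    rw [intervalIntegral.integral_finsetSum fun k _ =>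
      ((antitone_above (w k)).intervalIntegrable).const_mul _]
    refine Finset.sum_congr rfl fun k _ => ?_
    rw [intervalIntegral.integral_const_mul, integral_above (hw k).1 (hw k).2]
  have h2 : ∑ e ∈ E, α e * |u e - v e| =
      ∫ τ in (0 : ℝ)..M, ∑ e ∈ E, α e * |above (u e) τ - above (v e) τ| := by
    rw [intervalIntegral.integral_finsetSum fun e _ =>
      (integral_abs_above (hu e).1 (hu e).2 (hv e).1 (hv e).2).1.const_mul _]
    refine Finset.sum_congr rfl fun e _ => ?_
    rw [intervalIntegral.integral_const_mul,
      (integral_abs_above (hu e).1 (hu e).2 (hv e).1 (hv e).2).2]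
  rw [h1, h2]
  refine intervalIntegral.integral_mono_on hM ?_ ?_ fun τ hτ => h τ hτ.1
  · have := IntervalIntegrable.sum (μ := MeasureTheory.volume) (a := 0) (b := M) K
      (f := fun k τ => γ k * above (w k) τ) fun k _ =>
        ((antitone_above (w k)).intervalIntegrable).const_mul _
    rwa [Finset.sum_fn] at this
  · have := IntervalIntegrable.sum (μ := MeasureTheory.volume) (a := 0) (b := M) E
      (f := fun e τ => α e * |above (u e) τ - above (v e) τ|) fun e _ =>
      (integral_abs_above (hu e).1 (hu e).2 (hv e).1 (hv e).2).1.const_mul _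
    rwa [Finset.sum_fn] at this

theorem abs_above_eq_one {a b τ : ℝ} (h : ¬ (a ≤ τ ↔ b ≤ τ)) : |above a τ - above b τ| = 1 := by
  unfold above
  by_cases h1 : a ≤ τ
  · have h2 : τ < b := not_le.1 fun h2 => h (by simp [h1, h2])
    simp [not_lt.2 h1, h2]
  · have h2 : b ≤ τ := by_contra fun h2 => h (by simp [h1, h2])
    simp [not_lt.2 h2, not_le.1 h1]

/-- A potential varies along a connection by at least the difference of its end values. -/
theorem le_sum_abs_of_conn {V : Type*} {A : Finset (V × V)} {x y : V} (h : Conn A x y)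
    {φ : V → ℝ} {M : ℝ} (hφ : ∀ v, 0 ≤ φ v ∧ φ v ≤ M) (hx : φ x = 0) :
    φ y ≤ ∑ e ∈ A, |φ e.1 - φ e.2| := by
  have := sum_le_sum_of_level A {()} (fun _ => 1) (fun e => φ e.1) (fun e => φ e.2) (fun _ => 1)
    (fun _ => φ y) ((hφ x).1.trans (hφ x).2) (fun e => hφ e.1) (fun e => hφ e.2)
    (fun _ => hφ y) fun τ hτ => ?_
  · simpa using this
  · simp only [Finset.sum_singleton, one_mul]
    by_cases hy : τ < φ y
    · have : ∃ e ∈ A, ¬ (φ e.1 ≤ τ ↔ φ e.2 ≤ τ) := by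
        by_contra! hcon
        have := (h (fun v => φ v ≤ τ) hcon).1 (by rwa [hx])
        exact absurd this (not_le.2 hy)
      obtain ⟨e, he, hcross⟩ := this
      rw [above, if_pos hy, ← abs_above_eq_one hcross]
      exact Finset.single_le_sum (f := fun e : V × V => |above (φ e.1) τ - above (φ e.2) τ|)
        (fun e _ => abs_nonneg _) he
    · rw [above, if_neg hy]
      exact Finset.sum_nonneg fun e _ => abs_nonneg _

end LayerCake

/-! ### Multicast: disjoint balls and the factor 3. -/

section Multicast

variable {V : Type*} {d : V → V → ℝ}

/-- Disjoint balls use up distinct parts of an edge. -/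
theorem sum_abs_ball_le (hd : IsPseudoDist d) {ι : Type*} [Fintype ι] (z : ι → V) (b : ι → ℝ)
    (hb : ∀ i j, i ≠ j → b i + b j ≤ d (z i) (z j)) (x y : V) :
    ∑ i, |min (d (z i) x) (b i) - min (d (z i) y) (b i)| ≤ d x y := by
  classical
  have hout : ∀ v i, ¬ d (z i) v < b i → min (d (z i) v) (b i) = b i := fun v i h =>
    min_eq_right (not_lt.1 h)
  have hin : ∀ v i, d (z i) v < b i → min (d (z i) v) (b i) = d (z i) v := fun v i h =>
    min_eq_left h.le
  have hdisj : ∀ v i j, d (z i) v < b i → i ≠ j → ¬ d (z j) v < b j := by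
    intro v i j h1 hij h2
    have h3 := hd.tri (z i) v (z j)
    rw [hd.symm v] at h3
    linarith [hb i j hij]
  have hlip : ∀ i, |min (d (z i) x) (b i) - min (d (z i) y) (b i)| ≤ d x y := by
    intro i
    refine (abs_min_sub_min_le_max _ _ _ _).trans (max_le ?_ (by simpa using hd.nonneg x y))
    rw [abs_le]
    have h1 := hd.tri (z i) x y
    have h2 := hd.tri (z i) y x
    rw [hd.symm y x] at h2
    constructor <;> linarith
  have hzero : ∀ i, ¬ d (z i) x < b i → ¬ d (z i) y < b i →
      |min (d (z i) x) (b i) - min (d (z i) y) (b i)| = 0 := by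
    intro i h1 h2
    rw [hout _ _ h1, hout _ _ h2, sub_self, abs_zero]
  -- Each of `x` and `y` lies in at most one ball and every other summand vanishes. If the balls
  -- differ, the triangle inequality along `z i`, `x`, `y`, `z j` bounds the two remaining terms.
  by_cases hx : ∃ i, d (z i) x < b i
  · obtain ⟨i, hi⟩ := hx
    by_cases hy : ∃ j, j ≠ i ∧ d (z j) y < b j
    · obtain ⟨j, hji, hj⟩ := hy
      rw [← Finset.sum_subset (Finset.subset_univ {i, j}), Finset.sum_pair hji.symm,
        hin _ _ hi, hout _ _ (hdisj _ _ _ hj hji), hout _ _ (hdisj _ _ _ hi hji.symm), hin _ _ hj,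
        abs_of_nonpos (by linarith), abs_of_nonneg (by linarith)]
      · have h1 := hd.tri (z i) x (z j)
        have h2 := hd.tri x y (z j)
        rw [hd.symm y] at h2
        linarith [hb i j hji.symm]
      · intro k _ hk
        simp only [Finset.mem_insert, Finset.mem_singleton, not_or] at hk
        exact hzero k (hdisj _ _ _ hi (Ne.symm hk.1)) (hdisj _ _ _ hj (Ne.symm hk.2))
    · rw [Finset.sum_eq_single i]
      · exact hlip i
      · intro k _ hk
        exact hzero k (hdisj _ _ _ hi (Ne.symm hk)) fun h => hy ⟨k, hk, h⟩
      · simp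
  · by_cases hy : ∃ j, d (z j) y < b j
    · obtain ⟨j, hj⟩ := hy
      rw [Finset.sum_eq_single j]
      · exact hlip j
      · intro k _ hk
        exact hzero k (fun h => hx ⟨k, h⟩) (hdisj _ _ _ hj (Ne.symm hk))
      · simp
    · rw [Finset.sum_eq_zero]
      · exact hd.nonneg x y
      · intro k _
        exact hzero k (fun h => hx ⟨k, h⟩) fun h => hy ⟨k, h⟩

/-- The cost of connecting each node to the nearest other node or the root is at most twice the
weight of a Steiner tree. -/
theorem sum_nearest_le (hd : IsPseudoDist d) {ι : Type*} [Fintype ι] {r : V} (x : ι → V)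
    {A : Finset (V × V)} (hA : ∀ i, Conn A (x i) r) (D : ι → ℝ)
    (hD0 : ∀ i, 0 ≤ D i) (hDr : ∀ i, D i ≤ d (x i) r) (hD : ∀ i j, i ≠ j → D i ≤ d (x i) (x j)) :
    ∑ i, D i ≤ 2 * weight d A := by
  -- The open ball of radius `D i / 2` around `x i` does not contain the root, so `A` has to cross
  -- it completely; these balls are disjoint.
  have h1 : ∀ i, D i / 2 ≤ ∑ e ∈ A,
      |min (d (x i) e.1) (D i / 2) - min (d (x i) e.2) (D i / 2)| := by
    intro i
    have := le_sum_abs_of_conn (hA i) (φ := fun v => min (d (x i) v) (D i / 2)) (M := D i / 2)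
      (fun v => ⟨le_min (hd.nonneg _ _) (by linarith [hD0 i]), min_le_right _ _⟩)
      (by rw [hd.refl]; exact min_eq_left (by linarith [hD0 i]))
    refine le_trans (le_of_eq ?_) this
    exact (min_eq_right (by linarith [hD0 i, hDr i])).symm
  have h2 : ∑ i, D i / 2 ≤ weight d A := by
    refine (Finset.sum_le_sum fun i _ => h1 i).trans ?_
    rw [Finset.sum_comm]
    refine Finset.sum_le_sum fun e _ => sum_abs_ball_le hd x (fun i => D i / 2) (fun i j hij => ?_) _ _
    have h3 := hD i j hij
    have h4 := hD j i hij.symm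
    rw [hd.symm] at h4
    linarith
  rw [← Finset.sum_div] at h2
  linarith

open Classical in
theorem exists_min_weight [Finite V] (d : V → V → ℝ) (Q : Finset (V × V) → Prop)
    (hQ : ∃ A, Q A) : ∃ A, Q A ∧ ∀ A', Q A' → weight d A ≤ weight d A' :=
  Set.exists_min_image {A | Q A} (weight d) (Set.toFinite _) hQ

-- A minimum Steiner tree for the sample contributes 1. Joining a fresh source to the nearest
-- sampled source or the root contributes 2 by `sum_nearest_le`.
open ShortestPath in
open Classical in
theorem iInf_expectedSocialCost_multicastGame_le {V : Type*} [Finite V] (G : SimpleGraph V)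
    (c : G.edgeSet → ℝ≥0) (r : V) (n : ℕ) (ρ : PMF {s : V // G.Reachable s r}) :
    (⨅ s : {s // (multicastGame G c r (fun _ : Fin n => ρ)).IsStrategyProfile s},
      (multicastGame G c r (fun _ : Fin n => ρ)).expectedSocialCost s.1) ≤
      (3 : ℝ≥0) * (multicastGame G c r (fun _ : Fin n => ρ)).expectedOptCost := by
  obtain _ | m := n
  · exact BayesianNetworkDesignGame.iInf_expectedSocialCost_zero _ _
  set d := pathDist c with hdef
  have hd : IsPseudoDist d := isPseudoDist_pathDist c
  have := Fintype.ofFinite V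
  have hF : ∀ Y : Fin m → {s : V // G.Reachable s r}, ∃ A : Finset (V × V),
      (∀ i, Conn A (Y i).1 r) ∧ ∀ A', (∀ i, Conn A' (Y i).1 r) → weight d A ≤ weight d A' :=
    fun Y => exists_min_weight d _ ⟨Finset.univ, fun i =>
      Conn.of_mem (A := Finset.univ) (e := ((Y i).1, r)) (Finset.mem_univ _)⟩
  choose F hF hmin using hF
  have hnear : ∀ (Y : Fin m → {s : V // G.Reachable s r}) (x : V),
      ∃ y ∈ insert r (Set.range fun i => (Y i).1),
        ∀ y' ∈ insert r (Set.range fun i => (Y i).1), d x y ≤ d x y' := fun Y x =>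
    Set.exists_min_image _ _ (Set.toFinite _) ⟨r, Set.mem_insert _ _⟩
  choose near hnear hnear' using hnear
  refine iInf_expectedSocialCost_network_le (multicastGame G c r (fun _ : Fin (m + 1) => ρ))
    (fun _ => rfl) (fun t => (t.1, r)) (fun t => t.2) (fun _ _ => rfl) F
    (fun Y t => {(t.1, near Y t.1)}) (fun Y t => ?_) 3 (by norm_num) fun X A hA => ?_
  · have h1 : Conn (F Y ∪ {(t.1, near Y t.1)}) t.1 (near Y t.1) :=
      Conn.of_mem (e := (t.1, near Y t.1)) (Finset.mem_union_right _ (Finset.mem_singleton_self _))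
    refine h1.trans ?_
    rcases hnear Y t.1 with h | ⟨i, hi⟩
    · change near Y t.1 = r at h
      rw [h]; exact Conn.refl _ _
    · have := (hF Y i).mono (B := F Y ∪ {(t.1, near Y t.1)}) Finset.subset_union_left
      rwa [show (Y i).1 = near Y t.1 from hi] at this
  · change ∑ j, weight d _ + _ * ∑ j, weight d _ ≤ _ * (_ * weight d A)
    have h1 : ∑ j : Fin (m + 1), weight d (F (j.removeNth X)) ≤ (m + 1) * weight d A := by
      refine (Finset.sum_le_card_nsmul _ _ (weight d A) fun j _ => ?_).trans (by simp)
      exact hmin _ _ fun i => hA _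
    have h2 : ∑ j : Fin (m + 1),
        weight d {((X j).1, near (j.removeNth X : Fin m → {s : V // G.Reachable s r}) (X j).1)} ≤
        2 * weight d A := by
      simp only [weight, Finset.sum_singleton]
      refine sum_nearest_le hd (fun j => (X j).1) hA _ (fun i => hd.nonneg _ _) (fun i => ?_)
        fun i j hij => ?_
      · exact hnear' _ _ _ (Set.mem_insert _ _)
      · refine hnear' _ _ _ (Set.mem_insert_of_mem _ ?_)
        obtain ⟨k, rfl⟩ := Fin.exists_succAbove_eq hij.symm
        exact ⟨k, rfl⟩
    have h3 : (0 : ℝ) ≤ (m : ℝ) + 1 := by positivity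
    have h4 := mul_le_mul_of_nonneg_left h2 h3
    push_cast
    linarith

end Multicast

/-! ### Contracting a ball to a point. -/

section Contraction

variable {V : Type*}

/-- The metric obtained from `d` by contracting the ball of radius `b` around `z` to a point. -/
noncomputable def contract (d : V → V → ℝ) (z : V) (b : ℝ) (x y : V) : ℝ :=
  min (d x y) (max (d x z - b) 0 + max (d y z - b) 0)

theorem contract_le (d : V → V → ℝ) (z : V) (b : ℝ) (x y : V) : contract d z b x y ≤ d x y :=
  min_le_left _ _

theorem IsPseudoDist.contract {d : V → V → ℝ} (hd : IsPseudoDist d) (z : V) (b : ℝ) :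
    IsPseudoDist (contract d z b) where
  refl x := by
    rw [_root_.contract, hd.refl]
    exact min_eq_left (by positivity)
  symm x y := by rw [_root_.contract, _root_.contract, hd.symm, add_comm]
  tri x y w := by
    have h1 := hd.tri x y w
    have h2 := hd.tri x y z
    have h3 := hd.tri w y z
    rw [hd.symm w y] at h3
    have h4 : max (d x z - b) 0 ≤ d x y + max (d y z - b) 0 :=
      max_le (by linarith [le_max_left (d y z - b) 0])
        (by linarith [le_max_right (d y z - b) 0, hd.nonneg x y])
    have h5 : max (d w z - b) 0 ≤ d y w + max (d y z - b) 0 :=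
      max_le (by linarith [le_max_left (d y z - b) 0])
        (by linarith [le_max_right (d y z - b) 0, hd.nonneg y w])
    have h6 := le_max_right (d y z - b) 0
    have h7 := min_le_left (d x w) (max (d x z - b) 0 + max (d w z - b) 0)
    have h8 := min_le_right (d x w) (max (d x z - b) 0 + max (d w z - b) 0)
    unfold _root_.contract
    rcases min_choice (d x y) (max (d x z - b) 0 + max (d y z - b) 0) with h | h <;>
    rcases min_choice (d y w) (max (d y z - b) 0 + max (d w z - b) 0) with h' | h' <;>
    rw [h, h'] <;> linarith

/-- The distance to the centre, truncated at the radius, accounts for the loss of length. -/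
theorem abs_sub_add_contract_le {d : V → V → ℝ} (hd : IsPseudoDist d) (z : V) (b : ℝ) (x y : V) :
    |min (d z x) b - min (d z y) b| + contract d z b x y ≤ d x y := by
  have h1 := hd.tri x y z
  have h2 := hd.tri y x z
  rw [hd.symm y x] at h2
  rw [hd.symm z x, hd.symm z y]
  have h3 := min_le_left (d x y) (max (d x z - b) 0 + max (d y z - b) 0)
  have h4 := min_le_right (d x y) (max (d x z - b) 0 + max (d y z - b) 0)
  unfold contract
  rcases le_total (d x z) b with hx | hx <;> rcases le_total (d y z) b with hy | hy
  · rw [max_eq_right (by linarith), max_eq_right (by linarith)] at *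
    rw [min_eq_left hx, min_eq_left hy]
    have : |d x z - d y z| ≤ d x y := abs_le.2 ⟨by linarith, by linarith⟩
    linarith
  · rw [max_eq_right (by linarith), max_eq_left (by linarith)] at *
    rw [min_eq_left hx, min_eq_right hy, abs_of_nonpos (by linarith)]
    linarith
  · rw [max_eq_left (by linarith), max_eq_right (by linarith)] at *
    rw [min_eq_right hx, min_eq_left hy, abs_of_nonneg (by linarith)]
    linarith
  · rw [min_eq_right hx, min_eq_right hy, sub_self, abs_zero]
    linarith

/-- A distance that changes is realised through the ball, which saves its diameter. -/
theorem contract_through {d : V → V → ℝ} {z : V} {b : ℝ} {x y : V}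
    (hx : b ≤ d x z) (hy : b ≤ d y z) (h : contract d z b x y ≠ d x y) :
    contract d z b x y = d x z + d y z - 2 * b := by
  unfold contract at h ⊢
  rw [max_eq_left (by linarith), max_eq_left (by linarith)] at *
  rcases min_choice (d x y) (d x z - b + (d y z - b)) with h' | h'
  · exact absurd h' h
  · rw [h']; ring

/-- A connection to an end of `e` reaches one of the two ends before it uses `e`. -/
theorem Conn.of_insert [DecidableEq V] {B : Finset (V × V)} {e : V × V} {z : V}
    (h : Conn (insert e B) z e.1) : Conn B z e.1 ∨ Conn B z e.2 := by
  by_contra! hcon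
  refine hcon.1 ((h (fun v => Conn B z v) fun f hf => ?_).1 (Conn.refl _ _))
  rcases Finset.mem_insert.1 hf with rfl | hf
  · exact iff_of_false hcon.1 hcon.2
  · exact ⟨fun h => h.trans (Conn.of_mem hf), fun h => h.trans (Conn.of_mem hf).symm⟩

/-- A set of edges through a contracted ball whose centre is already connected to them can be
replaced without additional cost. -/
theorem exists_uncontract_of_conn [DecidableEq V] {d : V → V → ℝ} (hd : IsPseudoDist d) {z : V}
    {b : ℝ} (hb : 0 ≤ b) (Good : V → Prop) (hz : Good z) (A C : Finset (V × V))
    (hconn : ∀ e ∈ A, Conn (C ∪ A) z e.1)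
    (hgood : ∀ e ∈ A, (Good e.1 ∧ 2 * b ≤ d e.1 z) ∧ (Good e.2 ∧ 2 * b ≤ d e.2 z)) :
    ∃ A', (∀ e ∈ A', Good e.1 ∧ Good e.2) ∧ (∀ e ∈ A', Conn (C ∪ A') z e.1) ∧
      (∀ x y, Conn (C ∪ A) x y → Conn (C ∪ A') x y) ∧
      weight d A' ≤ weight (contract d z b) A := by
  induction A using Finset.induction_on generalizing C with
  | empty => exact ⟨∅, by simp, by simp, fun x y h => h, by simp [weight]⟩
  | insert e A he ih =>
    have key : ∃ e', (Good e'.1 ∧ Good e'.2) ∧ (e'.1 = e.1 ∨ e'.1 = e.2) ∧ d e'.1 e'.2 ≤ contract d z b e.1 e.2 ∧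
        ∀ x y, Conn (C ∪ insert e A) x y → Conn (insert e' C ∪ A) x y := by
      obtain ⟨⟨hg1, hb1⟩, hg2, hb2⟩ := hgood e (Finset.mem_insert_self _ _)
      -- An edge through the ball is exchanged for a spoke to the centre: without the edge, the
      -- centre is still joined to one end, and the spoke starts at the other. The omitted leg has
      -- length at least 2b, so the spoke is no dearer than the contracted edge.
      by_cases hthr : contract d z b e.1 e.2 = d e.1 e.2
      · refine ⟨e, ⟨hg1, hg2⟩, Or.inl rfl, hthr.ge, fun x y h => h.mono ?_⟩
        rw [Finset.union_insert, Finset.insert_union]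
      · have hval := contract_through (by linarith) (by linarith) hthr
        have hc := hconn e (Finset.mem_insert_self _ _)
        rw [Finset.union_insert] at hc
        have hlift : ∀ e' : V × V, Conn (insert e' C ∪ A) e.1 e.2 →
            ∀ x y, Conn (C ∪ insert e A) x y → Conn (insert e' C ∪ A) x y := by
          intro e' he' x y
          refine Conn.of_forall fun f hf => ?_
          simp only [Finset.mem_union, Finset.mem_insert] at hf
          rcases hf with hf | rfl | hf
          · exact Conn.of_mem (by simp [hf])
          · exact he'
          · exact Conn.of_mem (by simp [hf])
        have hsub : ∀ e' : V × V, C ∪ A ⊆ insert e' C ∪ A := fun e' =>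
          Finset.union_subset_union_left (Finset.subset_insert _ _)
        rcases hc.of_insert with h | h
        · refine ⟨(e.2, z), ⟨hg2, hz⟩, Or.inr rfl, by rw [hval]; linarith, hlift _ ?_⟩
          have h1 : Conn (insert (e.2, z) C ∪ A) e.2 z :=
            Conn.of_mem (e := (e.2, z)) (by simp)
          exact (h.mono (hsub _)).symm.trans h1.symm
        · refine ⟨(e.1, z), ⟨hg1, hz⟩, Or.inl rfl, by rw [hval]; linarith, hlift _ ?_⟩
          have h1 : Conn (insert (e.1, z) C ∪ A) e.1 z :=
            Conn.of_mem (e := (e.1, z)) (by simp)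
          exact h1.trans (h.mono (hsub _))
    -- The replacement edge joins the fixed part before the remaining edges are treated.
    obtain ⟨e', hg, hends, hle, hpres⟩ := key
    obtain ⟨A', hA1, hA2, hA3, hA4⟩ := ih (insert e' C)
      (fun f hf => hpres _ _ (hconn f (Finset.mem_insert_of_mem hf)))
      (fun f hf => hgood f (Finset.mem_insert_of_mem hf))
    have hset : insert e' C ∪ A' = C ∪ insert e' A' := by
      rw [Finset.insert_union, Finset.union_insert]
    rw [hset] at hA2 hA3
    refine ⟨insert e' A', fun f hf => ?_, fun f hf => ?_, fun x y h => hA3 x y (hpres x y h), ?_⟩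
    · rcases Finset.mem_insert.1 hf with rfl | hf
      · exact hg
      · exact hA1 f hf
    · rcases Finset.mem_insert.1 hf with rfl | hf
      · have h1 := hconn e (Finset.mem_insert_self _ _)
        have h2 : Conn (C ∪ insert e A) e.1 e.2 := Conn.of_mem (by simp)
        refine hA3 _ _ (hpres _ _ ?_)
        rcases hends with h | h
        · rwa [h]
        · rw [h]; exact h1.trans h2
      · exact hA2 f hf
    · have h1 := weight_union_le hd {e'} A'
      rw [weight, weight, Finset.sum_singleton] at h1
      rw [Finset.insert_eq]
      refine h1.trans ?_
      rw [weight, weight, Finset.sum_insert he]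
      exact add_le_add hle hA4

end Contraction

/-! ### Sequences of contracted balls and optimal forests. -/

section Balls

/-- A ball, owned by a pair of nodes. -/
structure Ball (V : Type*) where
  center : V
  radius : ℝ
  owner : V × V

variable {V : Type*}

/-- The metric after contracting a list of balls, the head of the list being the last one. -/
noncomputable def contracted (d : V → V → ℝ) : List (Ball V) → V → V → ℝ
  | [] => d
  | B :: zs => contract (contracted d zs) B.center B.radius

/-- The node `p` is far away from each ball at the time of its contraction. -/
def Far (d : V → V → ℝ) (p : V) : List (Ball V) → Prop
  | [] => True
  | B :: zs => 2 * B.radius ≤ contracted d zs p B.center ∧ Far d p zs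

/-- A sequence of balls with nonnegative radii, each of them with a centre far from the
earlier ones. -/
def Separated (d : V → V → ℝ) : List (Ball V) → Prop
  | [] => True
  | B :: zs => 0 ≤ B.radius ∧ Far d B.center zs ∧ Separated d zs

variable {d : V → V → ℝ}

theorem IsPseudoDist.contracted (hd : IsPseudoDist d) (zs : List (Ball V)) :
    IsPseudoDist (contracted d zs) := by
  induction zs with
  | nil => exact hd
  | cons B zs ih => exact ih.contract _ _

/-- Transfer of a set of edges from the contracted metric to the original one. The additional cost
is charged to representatives of the balls that become connected. -/
theorem exists_uncontract [DecidableEq V] (hd : IsPseudoDist d) {F R : Finset (V × V)}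
    (β : V × V → ℝ) (q : V) (zs : List (Ball V)) (hsep : Separated d zs)
    (hrep : ∀ B ∈ zs, ∃ m ∈ R, Conn F B.center m.1 ∧ B.radius ≤ β m)
    (A S : Finset (V × V)) (hfar : ∀ e ∈ A, Far d e.1 zs ∧ Far d e.2 zs)
    (hconn : ∀ e ∈ A, Conn (F ∪ A) q e.1) (hS : S ⊆ R) (hSq : ∀ m ∈ S, Conn (F ∪ A) q m.1) :
    ∃ A' S', S ⊆ S' ∧ S' ⊆ R ∧ (∀ m ∈ S', Conn (F ∪ A') q m.1) ∧
      (∀ x y, Conn (F ∪ A) x y → Conn (F ∪ A') x y) ∧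
      weight d A' ≤ weight (contracted d zs) A + ∑ m ∈ S' \ S, 2 * β m := by
  induction zs generalizing A S with
  | nil => exact ⟨A, S, subset_rfl, hS, hSq, fun x y h => h, by simp [contracted]⟩
  | cons B zs ih =>
    obtain ⟨hb, hcf, hsep⟩ := hsep
    have hd' := hd.contracted zs
    set d' := contracted d zs with hd'def
    have hrep' : ∀ B ∈ zs, ∃ m ∈ R, Conn F B.center m.1 ∧ B.radius ≤ β m := fun B' hB' =>
      hrep B' (List.mem_cons_of_mem _ hB')
    have key : ∃ A1 S1, S ⊆ S1 ∧ S1 ⊆ R ∧ (∀ m ∈ S1, Conn (F ∪ A1) q m.1) ∧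
        (∀ e ∈ A1, Far d e.1 zs ∧ Far d e.2 zs) ∧ (∀ e ∈ A1, Conn (F ∪ A1) q e.1) ∧
        (∀ x y, Conn (F ∪ A) x y → Conn (F ∪ A1) x y) ∧
        weight d' A1 ≤ weight (contract d' B.center B.radius) A + ∑ m ∈ S1 \ S, 2 * β m := by
      -- Undoing the last contraction is free if the centre is already connected to `q`, or if no
      -- edge uses the ball.
      by_cases hzq : Conn (F ∪ A) q B.center
      · obtain ⟨A1, h1, h2, h3, h4⟩ := exists_uncontract_of_conn hd' hb (fun v => Far d v zs) hcf
          A F (fun e he => hzq.symm.trans (hconn e he))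
          (fun e he => ⟨⟨(hfar e he).1.2, (hfar e he).1.1⟩, (hfar e he).2.2, (hfar e he).2.1⟩)
        exact ⟨A1, S, subset_rfl, hS, fun m hm => h3 _ _ (hSq m hm), h1,
          fun e he => (h3 _ _ hzq).trans (h2 e he), h3, by simpa using h4⟩
      by_cases hthr : ∀ e ∈ A, contract d' B.center B.radius e.1 e.2 = d' e.1 e.2
      · refine ⟨A, S, subset_rfl, hS, hSq, fun e he => ⟨(hfar e he).1.2, (hfar e he).2.2⟩, hconn,
          fun x y h => h, ?_⟩
        rw [Finset.sdiff_self, Finset.sum_empty, add_zero]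
        exact Finset.sum_le_sum fun e he => (hthr e he).ge
      push Not at hthr
      obtain ⟨e, he, hthr⟩ := hthr
      -- Otherwise one edge through the ball is replaced by both its legs, at an extra cost of twice
      -- the radius. The centre is then connected, so all further edges are free. The representative
      -- `m` was not in `S` before, so no representative is charged twice.
      obtain ⟨m, hmR, hmz, hmb⟩ := hrep B List.mem_cons_self
      have hval := contract_through (by linarith [(hfar e he).1.1]) (by linarith [(hfar e he).2.1])
        hthr
      set z := B.center with hz
      set C := insert (e.1, z) (insert (e.2, z) F) with hC
      have hCe1 : ∀ D, Conn (C ∪ D) e.1 z := fun D => Conn.of_mem (e := (e.1, z)) (by simp [hC])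
      have hCe2 : ∀ D, Conn (C ∪ D) e.2 z := fun D => Conn.of_mem (e := (e.2, z)) (by simp [hC])
      have hpres : ∀ x y, Conn (F ∪ A) x y → Conn (C ∪ A.erase e) x y := by
        intro x y
        refine Conn.of_forall fun f hf => ?_
        by_cases hfe : f = e
        · rw [hfe]; exact (hCe1 _).trans (hCe2 _).symm
        · refine Conn.of_mem ?_
          rcases Finset.mem_union.1 hf with hf | hf
          · simp [hC, hf]
          · simp [hf, hfe]
      have hqz : Conn (C ∪ A.erase e) q z := (hpres _ _ (hconn e he)).trans (hCe1 _)
      obtain ⟨A1, h1, h2, h3, h4⟩ := exists_uncontract_of_conn hd' hb (fun v => Far d v zs) hcf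
          (A.erase e) C
          (fun f hf => hqz.symm.trans (hpres _ _ (hconn f (Finset.mem_of_mem_erase hf))))
          (fun f hf => by
            have := hfar f (Finset.mem_of_mem_erase hf)
            exact ⟨⟨this.1.2, this.1.1⟩, this.2.2, this.2.1⟩)
      have hset : C ∪ A1 = F ∪ ({(e.1, z), (e.2, z)} ∪ A1) := by
        ext f; simp only [hC, Finset.mem_union, Finset.mem_insert, Finset.mem_singleton]; tauto
      rw [hset] at h2 h3
      have hmS : m ∉ S := fun hm => hzq ((hSq m hm).trans
        ((hmz.mono Finset.subset_union_left).symm))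
      have hq' := h3 _ _ hqz
      refine ⟨{(e.1, z), (e.2, z)} ∪ A1, insert m S, Finset.subset_insert _ _,
        Finset.insert_subset hmR hS, fun m' hm' => ?_, fun f hf => ?_, fun f hf => ?_,
        fun x y h => h3 _ _ (hpres _ _ h), ?_⟩
      · rcases Finset.mem_insert.1 hm' with rfl | hm'
        · exact hq'.trans (hmz.mono Finset.subset_union_left)
        · exact h3 _ _ (hpres _ _ (hSq m' hm'))
      · simp only [Finset.mem_union, Finset.mem_insert, Finset.mem_singleton] at hf
        rcases hf with (rfl | rfl) | hf
        · exact ⟨(hfar e he).1.2, hcf⟩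
        · exact ⟨(hfar e he).2.2, hcf⟩
        · exact h1 f hf
      · simp only [Finset.mem_union, Finset.mem_insert, Finset.mem_singleton] at hf
        rcases hf with (rfl | rfl) | hf
        · exact hq'.trans (h3 _ _ (hCe1 _)).symm
        · exact hq'.trans (h3 _ _ (hCe2 _)).symm
        · exact hq'.trans (h2 f hf)
      · have hsd : insert m S \ S = {m} := by
          rw [Finset.insert_sdiff_of_notMem _ hmS, Finset.sdiff_self]; rfl
        rw [hsd, Finset.sum_singleton]
        have g1 := weight_union_le hd' {(e.1, z), (e.2, z)} A1
        have g2 : weight d' {(e.1, z), (e.2, z)} ≤ d' e.1 z + d' e.2 z := by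
          have := weight_union_le hd' {(e.1, z)} {(e.2, z)}
          simpa [weight] using this
        have g3 : weight (contract d' z B.radius) A =
            weight (contract d' z B.radius) (A.erase e) + contract d' z B.radius e.1 e.2 :=
          (Finset.sum_erase_add _ _ he).symm
        linarith
    obtain ⟨A1, S1, h1, h2, h3, h4, h5, h6, h7⟩ := key
    obtain ⟨A', S', g1, g2, g3, g4, g5⟩ := ih hsep hrep' A1 S1 h4 h5 h2 h3
    refine ⟨A', S', h1.trans g1, g2, g3, fun x y h => g4 x y (h6 x y h), ?_⟩
    have h8 : ∑ m ∈ S' \ S, 2 * β m = ∑ m ∈ S' \ S1, 2 * β m + ∑ m ∈ S1 \ S, 2 * β m := by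
      rw [← Finset.sum_union (Finset.disjoint_left.2 fun m hm hm' =>
        (Finset.mem_sdiff.1 hm).2 (Finset.mem_sdiff.1 hm').1)]
      congr 1
      rw [Finset.sdiff_union_sdiff_cancel g1 h1]
    rw [h8]
    change weight d A' ≤ weight (contract d' B.center B.radius) A + _
    linarith

/-- `F` connects the pairs in `K`, and `R` contains a pair of at least the same length from the
component of each pair in `K`. -/
structure Dominates (d : V → V → ℝ) (K F R : Finset (V × V)) : Prop where
  subset : R ⊆ K
  conn : ∀ k ∈ K, Conn F k.1 k.2
  dom : ∀ k ∈ K, ∃ m ∈ R, Conn F k.1 m.1 ∧ d k.1 k.2 ≤ d m.1 m.2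

/-- An optimal forest, with a charge of twice the largest pair length for each component. -/
structure IsOptimalForest (d : V → V → ℝ) (K F R : Finset (V × V)) : Prop extends
    Dominates d K F R where
  minimal : ∀ F' R', Dominates d K F' R' → weight d F + 2 * weight d R ≤ weight d F' + 2 * weight d R'

theorem exists_isOptimalForest [Finite V] (d : V → V → ℝ) (K : Finset (V × V)) :
    ∃ F R, IsOptimalForest d K F R := by
  have := Fintype.ofFinite V
  obtain ⟨⟨F, R⟩, h1, h2⟩ := Set.exists_min_image
    {FR : Finset (V × V) × Finset (V × V) | Dominates d K FR.1 FR.2}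
    (fun FR => weight d FR.1 + 2 * weight d FR.2) (Set.toFinite _)
    ⟨(K, K), ⟨subset_rfl, fun k hk => Conn.of_mem hk, fun k hk => ⟨k, hk, Conn.refl _ _, le_rfl⟩⟩⟩
  exact ⟨F, R, h1, fun F' R' h => h2 (F', R') h⟩

/-- Merging components of an optimal forest is expensive. -/
theorem IsOptimalForest.merge [DecidableEq V] (hd : IsPseudoDist d) {K F R : Finset (V × V)}
    (hopt : IsOptimalForest d K F R) {S A : Finset (V × V)} (hS : S ⊆ R) {q : V}
    (hSq : ∀ m ∈ S, Conn (F ∪ A) q m.1) {mq : V × V} (hmq : mq ∈ S) {Λ : ℝ}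
    (hΛ : Λ ≤ d mq.1 mq.2) :
    2 * ∑ m ∈ S.erase mq, min (d m.1 m.2) Λ ≤ weight d A := by
  obtain ⟨M, hM, hmax⟩ := Finset.exists_max_image S (fun m => d m.1 m.2) ⟨mq, hmq⟩
  have hFsub : F ⊆ F ∪ A := Finset.subset_union_left
  -- The merged component keeps only its longest representative `M`, which saves twice the length of
  -- the others.
  have hdom : Dominates d K (F ∪ A) (insert M (R \ S)) := by
    refine ⟨Finset.insert_subset (hopt.subset (hS hM))
      (Finset.sdiff_subset.trans hopt.subset), fun k hk => (hopt.conn k hk).mono hFsub,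
      fun k hk => ?_⟩
    obtain ⟨m, hm, hc, hle⟩ := hopt.dom k hk
    by_cases hmS : m ∈ S
    · exact ⟨M, Finset.mem_insert_self _ _,
        (hc.mono hFsub).trans ((hSq m hmS).symm.trans (hSq M hM)), hle.trans (hmax m hmS)⟩
    · exact ⟨m, Finset.mem_insert_of_mem (Finset.mem_sdiff.2 ⟨hm, hmS⟩), hc.mono hFsub, hle⟩
  have h1 := hopt.minimal _ _ hdom
  have h2 := weight_union_le hd F A
  have h3 : weight d (insert M (R \ S)) = d M.1 M.2 + weight d (R \ S) :=
    Finset.sum_insert (by simp [hM])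
  have h4 : weight d (R \ S) + weight d S = weight d R := Finset.sum_sdiff hS
  have h5 : weight d (S.erase M) + d M.1 M.2 = weight d S := Finset.sum_erase_add _ _ hM
  have h6 := Finset.sum_erase_add S (fun m => min (d m.1 m.2) Λ) hmq
  have h7 := Finset.sum_erase_add S (fun m => min (d m.1 m.2) Λ) hM
  -- As `mq` attains the truncation level, omitting it instead of `M` does not increase the
  -- truncated sum.
  have h8 : min (d mq.1 mq.2) Λ = Λ := min_eq_right hΛ
  have h9 : min (d M.1 M.2) Λ ≤ Λ := min_le_right _ _
  have h10 : ∑ m ∈ S.erase M, min (d m.1 m.2) Λ ≤ weight d (S.erase M) :=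
    Finset.sum_le_sum fun m _ => min_le_left _ _
  linarith

/-- Edges between nodes that are far from the balls can be transferred to the original metric at
the loss of a constant factor, if one of the components they join is important. -/
theorem IsOptimalForest.exists_transfer [DecidableEq V] (hd : IsPseudoDist d)
    {K F R : Finset (V × V)} (hopt : IsOptimalForest d K F R) {zs : List (Ball V)}
    (hsep : Separated d zs) {Λ : ℝ}
    (hrep : ∀ B ∈ zs, ∃ m ∈ R, Conn F B.center m.1 ∧ 3 * B.radius ≤ min (d m.1 m.2) Λ)
    {A : Finset (V × V)} (hfar : ∀ e ∈ A, Far d e.1 zs ∧ Far d e.2 zs) {q : V} {mq : V × V}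
    (hmq : mq ∈ R) (hq : Conn F q mq.1) (hΛ : Λ ≤ d mq.1 mq.2)
    (hconn : ∀ e ∈ A, Conn (F ∪ A) q e.1) :
    ∃ A', (∀ x y, Conn (F ∪ A) x y → Conn (F ∪ A') x y) ∧
      weight d A' ≤ 3 / 2 * weight (contracted d zs) A := by
  obtain ⟨A', S', h1, h2, h3, h4, h5⟩ := exists_uncontract hd
    (fun m => min (d m.1 m.2) Λ / 3) q zs hsep
    (fun B hB => (hrep B hB).imp fun m h => ⟨h.1, h.2.1, by linarith [h.2.2]⟩) A {mq} hfar hconn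
    (Finset.singleton_subset_iff.2 hmq)
    (fun m hm => by
      rw [Finset.mem_singleton.1 hm]; exact hq.mono Finset.subset_union_left)
  refine ⟨A', h4, ?_⟩
  -- The charges are 2/3 of the truncated lengths, hence by merging at most a third of the weight of
  -- `A'`. Solving for that weight gives the factor 3/2.
  have h6 := hopt.merge hd h2 h3 (Finset.singleton_subset_iff.1 h1) hΛ
  rw [Finset.sdiff_singleton_eq_erase] at h5
  have h7 : ∑ m ∈ S'.erase mq, 2 * (min (d m.1 m.2) Λ / 3) =
      2 / 3 * ∑ m ∈ S'.erase mq, min (d m.1 m.2) Λ := by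
    rw [Finset.mul_sum]
    exact Finset.sum_congr rfl fun m _ => by ring
  rw [h7] at h5
  linarith

end Balls

/-! ### Choosing balls for one pair. -/

section Growth

variable {V : Type*} {d : V → V → ℝ}

/-- The requirements on a ball that is contracted after the balls `zs`. -/
structure BallAdmissible (d : V → V → ℝ) (later : V × V → Finset (V × V)) (zs : List (Ball V))
    (B : Ball V) : Prop where
  nonneg : 0 ≤ B.radius
  le_length : 3 * B.radius ≤ d B.owner.1 B.owner.2
  far : Far d B.center zs
  mono : ∀ B' ∈ zs, d B'.owner.1 B'.owner.2 ≤ d B.owner.1 B.owner.2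
  own : (B.center = B.owner.1 ∧ B.radius ≤ contracted d zs B.center B.owner.2) ∨
    (B.center = B.owner.2 ∧ B.radius ≤ contracted d zs B.center B.owner.1)
  far_later : ∀ q ∈ later B.owner,
    2 * B.radius ≤ contracted d zs q.1 B.center ∧ 2 * B.radius ≤ contracted d zs q.2 B.center

/-- Each ball of the list satisfies the requirements with respect to the balls before it. -/
def Admissible (d : V → V → ℝ) (later : V × V → Finset (V × V)) : List (Ball V) → Prop
  | [] => True
  | B :: zs => BallAdmissible d later zs B ∧ Admissible d later zs

variable {later : V × V → Finset (V × V)}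

theorem Admissible.separated {zs : List (Ball V)} (h : Admissible d later zs) :
    Separated d zs := by
  induction zs with
  | nil => trivial
  | cons B zs ih => exact ⟨h.1.nonneg, h.1.far, ih h.2⟩

theorem Admissible.forall_mem {zs : List (Ball V)} (h : Admissible d later zs) :
    ∀ B ∈ zs, 3 * B.radius ≤ d B.owner.1 B.owner.2 ∧
      (B.center = B.owner.1 ∨ B.center = B.owner.2) := by
  induction zs with
  | nil => simp
  | cons B zs ih =>
    intro B' hB'
    rcases List.mem_cons.1 hB' with rfl | hB'
    · exact ⟨h.1.le_length, h.1.own.imp And.left And.left⟩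
    · exact ih h.2 B' hB'

theorem Admissible.far {zs : List (Ball V)} (h : Admissible d later zs) {q : V × V}
    (hq : ∀ B ∈ zs, q ∈ later B.owner) : Far d q.1 zs ∧ Far d q.2 zs := by
  induction zs with
  | nil => exact ⟨trivial, trivial⟩
  | cons B zs ih =>
    have h1 := h.1.far_later q (hq B List.mem_cons_self)
    have h2 := ih h.2 fun B' hB' => hq B' (List.mem_cons_of_mem _ hB')
    exact ⟨⟨h1.1, h2.1⟩, h1.2, h2.2⟩

variable {K F R : Finset (V × V)}

theorem IsOptimalForest.exists_rep (hopt : IsOptimalForest d K F R) {zs : List (Ball V)}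
    (hadm : Admissible d later zs) (hown : ∀ B ∈ zs, B.owner ∈ K) {Λ : ℝ}
    (hΛ : ∀ B ∈ zs, d B.owner.1 B.owner.2 ≤ Λ) :
    ∀ B ∈ zs, ∃ m ∈ R, Conn F B.center m.1 ∧ 3 * B.radius ≤ min (d m.1 m.2) Λ := by
  intro B hB
  obtain ⟨m, hm, hc, hle⟩ := hopt.dom _ (hown B hB)
  obtain ⟨h1, h2⟩ := hadm.forall_mem B hB
  refine ⟨m, hm, ?_, le_min (h1.trans hle) (h1.trans (hΛ B hB))⟩
  rcases h2 with h2 | h2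
  · rwa [h2]
  · rw [h2]; exact (hopt.conn _ (hown B hB)).symm.trans hc

variable [DecidableEq V]

/-- The cost of connecting `s` and `t` is bounded by their contracted distance. -/
theorem IsOptimalForest.le_three_mul (hd : IsPseudoDist d) (hopt : IsOptimalForest d K F R)
    {zs : List (Ball V)} (hadm : Admissible d later zs) (hown : ∀ B ∈ zs, B.owner ∈ K) {s t : V}
    {g : ℝ} (hg : ∀ A, Conn (F ∪ A) s t → g ≤ weight d A) (hs : Far d s zs) (ht : Far d t zs) :
    g ≤ 3 * contracted d zs s t := by
  induction zs with
  | nil =>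
    have h1 := hg {(s, t)} (Conn.of_mem (e := (s, t)) (by simp))
    have h2 := hd.nonneg s t
    simp only [weight, Finset.sum_singleton] at h1
    simp only [contracted]
    linarith
  | cons B zs ih =>
    obtain ⟨hB, hadm'⟩ := hadm
    have hown' : ∀ B ∈ zs, B.owner ∈ K := fun B' hB' => hown B' (List.mem_cons_of_mem _ hB')
    have hb := hB.nonneg
    by_cases hthr : contract (contracted d zs) B.center B.radius s t = contracted d zs s t
    · change g ≤ 3 * contract _ _ _ s t
      rw [hthr]
      exact ih hadm' hown' hs.2 ht.2
    -- Both legs to the centre are at least twice the radius, so the contracted distance is at least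
    -- half of their sum. Connecting `s` and `t` through the centre costs at most 3/2 of that sum;
    -- here the owner's component is the important one, as earlier owners are no longer.
    · have hval := contract_through (by linarith [hs.1]) (by linarith [ht.1]) hthr
      change g ≤ 3 * contract _ _ _ s t
      rw [hval]
      obtain ⟨m, hm, hc, hle⟩ := hopt.dom _ (hown B List.mem_cons_self)
      have hc' : Conn F B.center m.1 := by
        rcases hB.own with h | h
        · rwa [h.1]
        · rw [h.1]; exact (hopt.conn _ (hown B List.mem_cons_self)).symm.trans hc
      have hmem : ∀ x ∈ ({(s, B.center), (t, B.center)} : Finset (V × V)),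
          Conn (F ∪ {(s, B.center), (t, B.center)}) x.1 B.center := by
        intro x hx
        have : x.2 = B.center := by
          simp only [Finset.mem_insert, Finset.mem_singleton] at hx
          rcases hx with rfl | rfl <;> rfl
        rw [← this]
        exact Conn.of_mem (Finset.mem_union_right _ (by rw [this]; exact hx))
      obtain ⟨A', h1, h2⟩ := hopt.exists_transfer hd hadm'.separated
        (hopt.exists_rep hadm' hown' (Λ := d B.owner.1 B.owner.2) hB.mono)
        (A := {(s, B.center), (t, B.center)}) (q := B.center)
        (fun e he => by
          simp only [Finset.mem_insert, Finset.mem_singleton] at he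
          rcases he with rfl | rfl
          · exact ⟨hs.2, hB.far⟩
          · exact ⟨ht.2, hB.far⟩)
        hm hc' hle (fun e he => (hmem e he).symm)
      have h3 := hg A' (h1 _ _ ((hmem (s, B.center) (by simp)).trans
        (hmem (t, B.center) (by simp)).symm))
      have h4 := weight_union_le (hd.contracted zs) {(s, B.center)} {(t, B.center)}
      rw [← Finset.insert_eq] at h4
      simp only [weight, Finset.sum_singleton] at h2 h4
      have h5 := hs.1
      have h6 := ht.1
      simp only [weight] at h3
      linarith

/-- A node of a component that is at least as important as the pair under consideration. -/
def Important (d : V → V → ℝ) (F R : Finset (V × V)) (zs : List (Ball V)) (Λ : ℝ) (u : V) : Prop :=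
  Far d u zs ∧ ∃ m ∈ R, Conn F u m.1 ∧ Λ ≤ d m.1 m.2

/-- The transfer with factor 3/2 needs an important component among those joined; the extra edge
from `s` to `u` supplies one. -/
theorem IsOptimalForest.le_of_important (hd : IsPseudoDist d) (hopt : IsOptimalForest d K F R)
    {zs : List (Ball V)} (hadm : Admissible d later zs) (hown : ∀ B ∈ zs, B.owner ∈ K) {s t : V}
    {Λ : ℝ} (hΛ : ∀ B ∈ zs, d B.owner.1 B.owner.2 ≤ Λ)
    {g : ℝ} (hg : ∀ A, Conn (F ∪ A) s t → g ≤ weight d A) (hs : Far d s zs) (ht : Far d t zs)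
    {u : V} (hu : Important d F R zs Λ u) :
    g ≤ 3 / 2 * (contracted d zs s t + contracted d zs s u) := by
  obtain ⟨huf, m, hm, hc, hle⟩ := hu
  have hst : Conn (F ∪ {(s, t), (s, u)}) s t := Conn.of_mem (e := (s, t)) (by simp)
  have hsu : Conn (F ∪ {(s, t), (s, u)}) s u := Conn.of_mem (e := (s, u)) (by simp)
  obtain ⟨A', h1, h2⟩ := hopt.exists_transfer hd hadm.separated (hopt.exists_rep hadm hown hΛ)
    (A := {(s, t), (s, u)}) (q := u)
    (fun e he => by
      simp only [Finset.mem_insert, Finset.mem_singleton] at he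
      rcases he with rfl | rfl
      · exact ⟨hs, ht⟩
      · exact ⟨hs, huf⟩)
    hm hc hle (fun e he => by
      simp only [Finset.mem_insert, Finset.mem_singleton] at he
      rcases he with rfl | rfl <;> exact hsu.symm)
  have h3 := hg A' (h1 _ _ hst)
  have h4 := weight_union_le (hd.contracted zs) {(s, t)} {(s, u)}
  rw [← Finset.insert_eq] at h4
  simp only [weight, Finset.sum_singleton] at h2 h3 h4
  linarith

/-- If `u` and `w` are in one component of `F`, the edges `s u` and `t w` already connect `s` with
`t`. Otherwise these two connections and a cheapest one between `s` and `t` merge two important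
components, which must cost at least 2Λ ≥ 2g; one g is paid by the last connection. -/
theorem IsOptimalForest.le_of_important_pair (hd : IsPseudoDist d)
    (hopt : IsOptimalForest d K F R) {zs : List (Ball V)} (hadm : Admissible d later zs)
    (hown : ∀ B ∈ zs, B.owner ∈ K) {s t : V} {Λ : ℝ} (hΛ : ∀ B ∈ zs, d B.owner.1 B.owner.2 ≤ Λ)
    {g : ℝ} (hg : ∀ A, Conn (F ∪ A) s t → g ≤ weight d A) (hgΛ : g ≤ Λ)
    (hg' : ∃ A, Conn (F ∪ A) s t ∧ weight d A = g) (hs : Far d s zs) (ht : Far d t zs)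
    {u w : V} (hu : Important d F R zs Λ u) (hw : Important d F R zs Λ w) :
    g ≤ 3 / 2 * (contracted d zs s u + contracted d zs t w) := by
  obtain ⟨huf, m, hm, hc, hle⟩ := hu
  obtain ⟨hwf, m', hm', hc', hle'⟩ := hw
  by_cases huw : Conn F u w
  · have hsu : Conn (F ∪ {(s, u), (t, w)}) s u := Conn.of_mem (e := (s, u)) (by simp)
    have htw : Conn (F ∪ {(s, u), (t, w)}) t w := Conn.of_mem (e := (t, w)) (by simp)
    have huw' : Conn (F ∪ {(s, u), (t, w)}) u w := huw.mono Finset.subset_union_left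
    obtain ⟨A', h1, h2⟩ := hopt.exists_transfer hd hadm.separated (hopt.exists_rep hadm hown hΛ)
      (A := {(s, u), (t, w)}) (q := u)
      (fun e he => by
        simp only [Finset.mem_insert, Finset.mem_singleton] at he
        rcases he with rfl | rfl
        · exact ⟨hs, huf⟩
        · exact ⟨ht, hwf⟩)
      hm hc hle (fun e he => by
        simp only [Finset.mem_insert, Finset.mem_singleton] at he
        rcases he with rfl | rfl
        · exact hsu.symm
        · exact huw'.trans htw.symm)
    have h3 := hg A' (h1 _ _ (hsu.trans (huw'.trans htw.symm)))
    have h4 := weight_union_le (hd.contracted zs) {(s, u)} {(t, w)}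
    rw [← Finset.insert_eq] at h4
    simp only [weight, Finset.sum_singleton] at h2 h3 h4
    linarith
  · have single : ∀ {x v : V} {k : V × V}, Far d x zs → Far d v zs → k ∈ R → Conn F v k.1 →
        Λ ≤ d k.1 k.2 → ∃ A', Conn (F ∪ A') x v ∧ weight d A' ≤ 3 / 2 * contracted d zs x v := by
      intro x v k hx hv hk hck hlek
      have hxv : Conn (F ∪ {(x, v)}) x v := Conn.of_mem (e := (x, v)) (by simp)
      obtain ⟨A', h1, h2⟩ := hopt.exists_transfer hd hadm.separated
        (hopt.exists_rep hadm hown hΛ) (A := {(x, v)}) (q := v)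
        (fun e he => by rw [Finset.mem_singleton.1 he]; exact ⟨hx, hv⟩)
        hk hck hlek (fun e he => by rw [Finset.mem_singleton.1 he]; exact hxv.symm)
      exact ⟨A', h1 _ _ hxv, by simpa [weight] using h2⟩
    obtain ⟨A₁, h1, h2⟩ := single hs huf hm hc hle
    obtain ⟨A₂, h3, h4⟩ := single ht hwf hm' hc' hle'
    obtain ⟨A₃, h5, h6⟩ := hg'
    have hmm : m ≠ m' := fun h => huw (hc.trans (by rw [h]; exact hc'.symm))
    have g1 : Conn (F ∪ (A₁ ∪ A₂ ∪ A₃)) s u := h1.mono (by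
      intro x; simp only [Finset.mem_union]; tauto)
    have g2 : Conn (F ∪ (A₁ ∪ A₂ ∪ A₃)) t w := h3.mono (by
      intro x; simp only [Finset.mem_union]; tauto)
    have g3 : Conn (F ∪ (A₁ ∪ A₂ ∪ A₃)) s t := h5.mono (by
      intro x; simp only [Finset.mem_union]; tauto)
    have g4 : ∀ {x y}, Conn F x y → Conn (F ∪ (A₁ ∪ A₂ ∪ A₃)) x y := fun h =>
      h.mono Finset.subset_union_left
    have h7 := hopt.merge hd (S := {m, m'}) (A := A₁ ∪ A₂ ∪ A₃) (q := u) (mq := m) (Λ := Λ)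
      (by intro x hx; simp only [Finset.mem_insert, Finset.mem_singleton] at hx
          rcases hx with rfl | rfl <;> assumption)
      (by intro x hx; simp only [Finset.mem_insert, Finset.mem_singleton] at hx
          rcases hx with rfl | rfl
          · exact g4 hc
          · exact (g1.symm.trans g3).trans (g2.trans (g4 hc')))
      (by simp) hle
    have h8 : ({m, m'} : Finset (V × V)).erase m = {m'} := by
      rw [Finset.erase_insert (by simpa using hmm)]
    rw [h8, Finset.sum_singleton, min_eq_right hle'] at h7
    have h9 := weight_union_le hd (A₁ ∪ A₂) A₃
    have h10 := weight_union_le hd A₁ A₂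
    linarith

/-- For each pair one can contract one or two balls of total radius one third of its cost. -/
theorem IsOptimalForest.exists_balls (hd : IsPseudoDist d) (hopt : IsOptimalForest d K F R)
    {zs : List (Ball V)} (hadm : Admissible d later zs) (hown : ∀ B ∈ zs, B.owner ∈ K)
    {j : V × V} (hΛ : ∀ B ∈ zs, d B.owner.1 B.owner.2 ≤ d j.1 j.2)
    {g : ℝ} (hg : ∀ A, Conn (F ∪ A) j.1 j.2 → g ≤ weight d A)
    (hg' : ∃ A, Conn (F ∪ A) j.1 j.2 ∧ weight d A = g)
    (hj : ∀ B ∈ zs, j ∈ later B.owner)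
    (hlater : ∀ q ∈ later j, q ∈ K ∧ d j.1 j.2 ≤ d q.1 q.2 ∧ ∀ B ∈ zs, q ∈ later B.owner) :
    ∃ ns : List (Ball V), (∀ B ∈ ns, B.owner = j) ∧ (ns.map Ball.radius).sum = g / 3 ∧
      Admissible d later (ns ++ zs) := by
  obtain ⟨hs, ht⟩ := hadm.far hj
  set Λ := d j.1 j.2 with hΛdef
  obtain ⟨s, t⟩ := j
  simp only at hs ht hΛdef hg hg'
  set D := contracted d zs with hD
  have hDp : IsPseudoDist D := hd.contracted zs
  have hgΛ : g ≤ Λ := by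
    have := hg {(s, t)} (Conn.of_mem (e := (s, t)) (by simp))
    simpa [weight] using this
  have hg0 : 0 ≤ g := by obtain ⟨A, _, h⟩ := hg'; rw [← h]; exact weight_nonneg hd _
  have F1 : g ≤ 3 * D s t := hopt.le_three_mul hd hadm hown hg hs ht
  have hg_symm : ∀ A, Conn (F ∪ A) t s → g ≤ weight d A := fun A h => hg A h.symm
  set U := (later (s, t)).image Prod.fst ∪ (later (s, t)).image Prod.snd with hU
  have hq1 : ∀ q ∈ later (s, t), q.1 ∈ U := fun q hq =>
    Finset.mem_union_left _ (Finset.mem_image_of_mem _ hq)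
  have hq2 : ∀ q ∈ later (s, t), q.2 ∈ U := fun q hq =>
    Finset.mem_union_right _ (Finset.mem_image_of_mem _ hq)
  have himp : ∀ u ∈ U, Important d F R zs Λ u := by
    have h : ∀ q ∈ later (s, t), Important d F R zs Λ q.1 ∧ Important d F R zs Λ q.2 := by
      intro q hq
      obtain ⟨hqK, hle, hql⟩ := hlater q hq
      obtain ⟨m, hm, hc, hlm⟩ := hopt.dom q hqK
      have hf := hadm.far hql
      exact ⟨⟨hf.1, m, hm, hc, hle.trans hlm⟩,
        ⟨hf.2, m, hm, (hopt.conn q hqK).symm.trans hc, hle.trans hlm⟩⟩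
    intro u hu
    rcases Finset.mem_union.1 hu with hu | hu
    · obtain ⟨q, hq, rfl⟩ := Finset.mem_image.1 hu; exact (h q hq).1
    · obtain ⟨q, hq, rfl⟩ := Finset.mem_image.1 hu; exact (h q hq).2
  have F2 : ∀ u ∈ U, ∀ w ∈ U, g ≤ 3 / 2 * (D s u + D t w) := fun u hu w hw =>
    hopt.le_of_important_pair hd hadm hown hΛ hg hgΛ hg' hs ht (himp u hu) (himp w hw)
  have F3s : ∀ u ∈ U, g ≤ 3 / 2 * (D s t + D s u) := fun u hu =>
    hopt.le_of_important hd hadm hown hΛ hg hs ht (himp u hu)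
  have F3t : ∀ u ∈ U, g ≤ 3 / 2 * (D s t + D t u) := fun u hu => by
    rw [hDp.symm s t]
    exact hopt.le_of_important hd hadm hown hΛ hg_symm ht hs (himp u hu)
  -- If all ends of later pairs are far from `s`, one ball at `s` suffices, and `F1` keeps `t` out
  -- of its interior.
  by_cases hcs : ∀ u ∈ U, 2 * g / 3 ≤ D s u
  · refine ⟨[⟨s, g / 3, (s, t)⟩], by simp, by simp, ⟨?_, ?_, hs, hΛ, Or.inl ⟨rfl, ?_⟩, ?_⟩, hadm⟩
    · dsimp only; linarith
    · dsimp only; linarith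
    · change g / 3 ≤ D s t; linarith
    · intro q hq
      change 2 * (g / 3) ≤ D q.1 s ∧ 2 * (g / 3) ≤ D q.2 s
      rw [hDp.symm, hDp.symm q.2]
      exact ⟨by linarith [hcs _ (hq1 q hq)], by linarith [hcs _ (hq2 q hq)]⟩
  by_cases hct : ∀ u ∈ U, 2 * g / 3 ≤ D t u
  · refine ⟨[⟨t, g / 3, (s, t)⟩], by simp, by simp, ⟨?_, ?_, ht, hΛ, Or.inr ⟨rfl, ?_⟩, ?_⟩, hadm⟩
    · dsimp only; linarith
    · dsimp only; linarith
    · change g / 3 ≤ D t s; rw [hDp.symm]; linarith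
    · intro q hq
      change 2 * (g / 3) ≤ D q.1 t ∧ 2 * (g / 3) ≤ D q.2 t
      rw [hDp.symm, hDp.symm q.2]
      exact ⟨by linarith [hct _ (hq1 q hq)], by linarith [hct _ (hq2 q hq)]⟩
  push Not at hcs hct
  obtain ⟨u₀, hu₀, hu₀'⟩ := hcs
  obtain ⟨w₀, hw₀, hw₀'⟩ := hct
  obtain ⟨u, hu, humin⟩ := Finset.exists_min_image U (D s) ⟨u₀, hu₀⟩
  obtain ⟨w, hw, hwmin⟩ := Finset.exists_min_image U (D t) ⟨u₀, hu₀⟩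
  have hu3 := humin u₀ hu₀
  have f1 := F2 u hu w hw
  have f2 := F3s u hu
  have f3 := F3t w hw
  -- The ball at `s` is as large as the later ends and `t` permit. The remaining radius fits at `t`:
  -- by `F2` and `F3s` if the nearest later end is the constraint, by `F1` and `F3t` if `t` is.
  set bs := min (D s u) (D s t) / 2 with hbs
  set bt := g / 3 - bs with hbt
  have hbs0 : 0 ≤ bs := by
    have := le_min (hDp.nonneg s u) (hDp.nonneg s t); linarith
  have hbs1 : 2 * bs ≤ D s u := by have := min_le_left (D s u) (D s t); linarith
  have hbs2 : 2 * bs ≤ D s t := by have := min_le_right (D s u) (D s t); linarith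
  have hbt0 : 0 ≤ bt := by linarith
  have hbt12 : 2 * bt ≤ D t w ∧ 2 * bt ≤ D s t := by
    rcases min_choice (D s u) (D s t) with h | h <;> rw [h] at hbs <;>
      constructor <;> linarith
  set D' := contract D s bs with hD'
  have hD'p : IsPseudoDist D' := hDp.contract _ _
  have hfars : ∀ v ∈ U, 2 * bs ≤ D v s := fun v hv => by
    rw [hDp.symm]; linarith [humin v hv]
  -- The ball at `t` lives in the metric where the one at `s` is contracted; routes through the
  -- latter are long enough by `F3s`.
  have hfart : ∀ v ∈ U, 2 * bt ≤ D' v t := fun v hv => by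
    refine le_min ?_ ?_
    · rw [hDp.symm]; linarith [hwmin v hv]
    · have h1 := le_max_left (D v s - bs) 0
      have h2 := le_max_left (D t s - bs) 0
      rw [hDp.symm t s] at *
      rw [hDp.symm v s] at *
      linarith [F3s v hv]
  have hts : bt ≤ D' t s := by
    refine le_min (by rw [hDp.symm]; linarith [hDp.nonneg s t, hbt12.2]) ?_
    have h1 := le_max_left (D t s - bs) 0
    have h2 := le_max_right (D s s - bs) 0
    rw [hDp.symm t s] at *
    linarith
  have hadms : Admissible d later (⟨s, bs, (s, t)⟩ :: zs) := by
    refine ⟨⟨hbs0, ?_, hs, hΛ, Or.inl ⟨rfl, ?_⟩, fun q hq => ⟨hfars _ (hq1 q hq),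
      hfars _ (hq2 q hq)⟩⟩, hadm⟩
    · dsimp only; linarith
    · change bs ≤ D s t; linarith
  refine ⟨[⟨t, bt, (s, t)⟩, ⟨s, bs, (s, t)⟩], by simp, by simp [hbt],
    ⟨hbt0, ?_, ⟨?_, ht⟩, ?_, Or.inr ⟨rfl, hts⟩, fun q hq => ⟨hfart _ (hq1 q hq),
      hfart _ (hq2 q hq)⟩⟩, hadms⟩
  · dsimp only; linarith
  · change 2 * bs ≤ D t s; rw [hDp.symm]; exact hbs2
  · intro B' hB'
    rcases List.mem_cons.1 hB' with rfl | hB'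
    · exact le_rfl
    · exact hΛ B' hB'

end Growth

/-! ### Components of a solution and halved path weights. -/

section Components

variable {V : Type*} {d : V → V → ℝ}

theorem Conn.exists_cross {A : Finset (V × V)} {x y : V} (h : Conn A x y) (P : V → Prop)
    (hxy : ¬ (P x ↔ P y)) : ∃ e ∈ A, ¬ (P e.1 ↔ P e.2) := by
  by_contra! hcon
  exact hxy (h P hcon)

open Classical in
/-- The edges of `T` in the component of `v`. -/
noncomputable def component (T : Finset (V × V)) (v : V) : Finset (V × V) :=
  T.filter fun e => Conn T v e.1

theorem mem_component {T : Finset (V × V)} {v : V} {e : V × V} :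
    e ∈ component T v ↔ e ∈ T ∧ Conn T v e.1 := by
  classical exact Finset.mem_filter

/-- A predicate respected by the component is extended by `True` outside it and is then respected by
all of `T`. -/
theorem conn_component {T : Finset (V × V)} {v x y : V} (hx : Conn T v x) (h : Conn T x y) :
    Conn (component T v) x y := by
  intro P hP
  have h1 := h (fun w => Conn T v w → P w) fun e he => by
    by_cases hc : Conn T v e.1
    · have h2 : Conn T v e.2 := hc.trans (Conn.of_mem he)
      have h3 := hP e (mem_component.2 ⟨he, hc⟩)
      simp [hc, h2, h3]
    · have h2 : ¬ Conn T v e.2 := fun h2 => hc (h2.trans (Conn.of_mem he).symm)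
      simp [hc, h2]
  simpa [hx, hx.trans h] using h1

theorem sum_weight_component_le (hd : IsPseudoDist d) {T S : Finset (V × V)}
    (hS : ∀ m ∈ S, ∀ m' ∈ S, Conn T m.1 m'.1 → m = m') :
    ∑ m ∈ S, weight d (component T m.1) ≤ weight d T := by
  classical
  have hdisj : Set.PairwiseDisjoint (S : Set (V × V)) fun m => component T m.1 := by
    intro m hm m' hm' hne
    refine Finset.disjoint_left.2 fun e he he' => hne (hS m hm m' hm' ?_)
    exact (mem_component.1 he).2.trans (mem_component.1 he').2.symm
  have h1 : ∑ m ∈ S, weight d (component T m.1) = weight d (S.biUnion fun m => component T m.1) :=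
    (Finset.sum_biUnion hdisj).symm
  rw [h1]
  exact weight_mono hd (Finset.biUnion_subset.2 fun m _ e he =>
    (mem_component.1 he).1)

theorem dist_le_weight (hd : IsPseudoDist d) {A : Finset (V × V)} {x y : V} (h : Conn A x y) :
    d x y ≤ weight d A := by
  have h1 := le_sum_abs_of_conn h (φ := fun v => min (d x v) (d x y)) (M := d x y)
    (fun v => ⟨le_min (hd.nonneg _ _) (hd.nonneg _ _), min_le_right _ _⟩)
    (by rw [hd.refl]; exact min_eq_left (hd.nonneg _ _))
  rw [min_self] at h1
  refine h1.trans (Finset.sum_le_sum fun e _ => ?_)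
  have := abs_sub_add_contract_le hd x (d x y) e.1 e.2
  have h2 := (hd.contract x (d x y)).nonneg e.1 e.2
  linarith

theorem exists_minimal_conn [DecidableEq V] {A : Finset (V × V)} {x y : V} (h : Conn A x y) :
    ∃ Q ⊆ A, Conn Q x y ∧ ∀ e ∈ Q, ¬ Conn (Q.erase e) x y := by
  induction A using Finset.strongInduction with
  | H A ih =>
    by_cases hA : ∃ e ∈ A, Conn (A.erase e) x y
    · obtain ⟨e, he, hc⟩ := hA
      obtain ⟨Q, h1, h2⟩ := ih _ (Finset.erase_ssubset he) hc
      exact ⟨Q, h1.trans (Finset.erase_subset _ _), h2⟩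
    · push Not at hA
      exact ⟨A, subset_rfl, h, hA⟩

/-- If the weights of a minimal connection between `s` and `t` are halved, the variation of a
potential that vanishes at `z` is still at least the mean of its values at `s` and `t`. -/
theorem half_add_half_le [DecidableEq V] {T Q : Finset (V × V)} {s t z : V} (hQ : Q ⊆ T)
    (hst : Conn Q s t) (hmin : ∀ e ∈ Q, ¬ Conn (Q.erase e) s t) (hs : Conn T z s)
    {φ : V → ℝ} {M : ℝ} (hφ : ∀ v, 0 ≤ φ v ∧ φ v ≤ M) (hz : φ z = 0) :
    1 / 2 * φ s + 1 / 2 * φ t ≤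
      ∑ e ∈ T, (1 - if e ∈ Q then 1 / 2 else 0) * |φ e.1 - φ e.2| := by
  have := sum_le_sum_of_level T (Finset.univ : Finset Bool)
    (fun e => 1 - if e ∈ Q then (1 / 2 : ℝ) else 0) (fun e => φ e.1) (fun e => φ e.2)
    (fun _ => 1 / 2) (fun b => if b then φ s else φ t) ((hφ z).1.trans (hφ z).2)
    (fun e => hφ e.1) (fun e => hφ e.2) (fun b => by cases b <;> simp [hφ]) fun τ hτ => ?_
  · simpa using this
  set X : V × V → ℝ := fun e => |above (φ e.1) τ - above (φ e.2) τ| with hX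
  have hX0 : ∀ e, 0 ≤ X e := fun e => abs_nonneg _
  have hX1 : ∀ e : V × V, ¬ (φ e.1 ≤ τ ↔ φ e.2 ≤ τ) → X e = 1 := fun e he => abs_above_eq_one he
  have hsum : ∑ e ∈ T, (1 - if e ∈ Q then (1 / 2 : ℝ) else 0) * X e =
      ∑ e ∈ T, X e - 1 / 2 * ∑ e ∈ Q, X e := by
    simp only [sub_mul, one_mul, Finset.sum_sub_distrib, ite_mul, zero_mul]
    rw [← Finset.sum_filter, Finset.filter_mem_eq_inter, Finset.inter_eq_right.2 hQ,
      Finset.mul_sum]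
  have hle : ∑ e ∈ Q, X e ≤ ∑ e ∈ T, X e :=
    Finset.sum_le_sum_of_subset_of_nonneg hQ fun e _ _ => hX0 e
  have hQ0 : 0 ≤ ∑ e ∈ Q, X e := Finset.sum_nonneg fun e _ => hX0 e
  have hone : ∀ {A : Finset (V × V)} {x y : V}, Conn A x y → ¬ (φ x ≤ τ ↔ φ y ≤ τ) →
      1 ≤ ∑ e ∈ A, X e := by
    intro A x y h hxy
    obtain ⟨e, he, hcr⟩ := h.exists_cross (fun v => φ v ≤ τ) hxy
    rw [← hX1 e hcr]
    exact Finset.single_le_sum (f := X) (fun e _ => hX0 e) he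
  rw [hsum]
  simp only [Fintype.sum_bool, if_true, Bool.false_eq_true, if_false]
  -- If the level separates `s` from `t`, then `Q` crosses it, with weight at least 1/2. If both are
  -- above it, then either `Q` does not cross and `T` does with full weight 1, or `Q` crosses at
  -- least twice.
  by_cases h1 : φ s ≤ τ <;> by_cases h2 : φ t ≤ τ
  · rw [above, above, if_neg (not_lt.2 h1), if_neg (not_lt.2 h2)]; linarith
  · have := hone hst (by simp [h1, h2])
    rw [above, above, if_neg (not_lt.2 h1), if_pos (not_le.1 h2)]; linarith
  · have := hone hst (by simp [h1, h2])
    rw [above, above, if_pos (not_le.1 h1), if_neg (not_lt.2 h2)]; linarith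
  · have hT := hone hs (by simp [h1, hz, hτ])
    rw [above, above, if_pos (not_le.1 h1), if_pos (not_le.1 h2)]
    by_cases hcr : ∃ f ∈ Q, ¬ (φ f.1 ≤ τ ↔ φ f.2 ≤ τ)
    · obtain ⟨f, hf, hcr⟩ := hcr
      have h3 : ∃ f' ∈ Q.erase f, ¬ (φ f'.1 ≤ τ ↔ φ f'.2 ≤ τ) := by
        by_contra! hcon
        refine hmin f hf fun P hP => ?_
        -- Suppose `f` is the only crossing edge. A predicate respected by `Q.erase f`, overwritten
        -- below the level by its value at the upper end of `f`, is respected by `Q`. As `s` and `t`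
        -- lie above, `f` would be superfluous, against minimality.
        have key : ∃ c : Prop, ∀ e ∈ Q, ((if φ e.1 ≤ τ then c else P e.1) ↔
            (if φ e.2 ≤ τ then c else P e.2)) := by
          refine ⟨if φ f.1 ≤ τ then P f.2 else P f.1, fun e he => ?_⟩
          by_cases hef : e = f
          · subst hef
            by_cases h4 : φ e.1 ≤ τ <;> by_cases h5 : φ e.2 ≤ τ <;> simp_all
          · have h4 := hcon e (Finset.mem_erase.2 ⟨hef, he⟩)
            have h5 := hP e (Finset.mem_erase.2 ⟨hef, he⟩)
            by_cases h6 : φ e.1 ≤ τ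
            · rw [if_pos h6, if_pos (h4.1 h6)]
            · rw [if_neg h6, if_neg (fun h => h6 (h4.2 h)), h5]
        obtain ⟨c, hc⟩ := key
        have := hst (fun v => if φ v ≤ τ then c else P v) hc
        simpa [h1, h2] using this
      obtain ⟨f', hf', hcr'⟩ := h3
      have h4 : X f + X f' ≤ ∑ e ∈ Q, X e := by
        rw [← Finset.sum_pair (Finset.ne_of_mem_erase hf').symm]
        exact Finset.sum_le_sum_of_subset_of_nonneg
          (Finset.insert_subset hf (Finset.singleton_subset_iff.2 (Finset.mem_of_mem_erase hf')))
          fun e _ _ => hX0 e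
      rw [hX1 f hcr, hX1 f' hcr'] at h4
      linarith
    · push Not at hcr
      have h3 : ∑ e ∈ Q, X e = 0 := Finset.sum_eq_zero fun e he => by
        have h4 := hcr e he
        simp only [hX, above]
        by_cases h5 : φ e.1 ≤ τ
        · rw [if_neg (not_lt.2 h5), if_neg (not_lt.2 (h4.1 h5))]; simp
        · rw [if_pos (not_le.1 h5), if_pos (not_le.1 fun h => h5 (h4.2 h))]; simp
      linarith

end Components

/-! ### Total augmentation cost against an arbitrary solution. -/

section Accounting

variable {V : Type*} {d : V → V → ℝ} {ι : Type*} [LinearOrder ι]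

open Classical in
/-- The pairs in `K` that are the last ones of their component of `T`. -/
noncomputable def lastPairs (ord : V × V → ι) (K T : Finset (V × V)) : Finset (V × V) :=
  K.filter fun m => ∀ q ∈ K, Conn T m.1 q.1 → ord q ≤ ord m

/-- The pairs in `K` after a given pair. -/
def laterPairs (ord : V × V → ι) (K : Finset (V × V)) (k : V × V) : Finset (V × V) :=
  K.filter fun q => ord k < ord q

variable {ord : V × V → ι} {K T : Finset (V × V)}

theorem mem_lastPairs {m : V × V} :
    m ∈ lastPairs ord K T ↔ m ∈ K ∧ ∀ q ∈ K, Conn T m.1 q.1 → ord q ≤ ord m := by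
  classical exact Finset.mem_filter

theorem lastPairs_subset : lastPairs ord K T ⊆ K := fun _ hm => (mem_lastPairs.1 hm).1

theorem exists_lastPairs {k : V × V} (hk : k ∈ K) :
    ∃ m ∈ lastPairs ord K T, Conn T k.1 m.1 ∧ ord k ≤ ord m := by
  classical
  obtain ⟨m, hm, hmax⟩ := Finset.exists_max_image (K.filter fun q => Conn T k.1 q.1) ord
    ⟨k, Finset.mem_filter.2 ⟨hk, Conn.refl _ _⟩⟩
  rw [Finset.mem_filter] at hm
  refine ⟨m, mem_lastPairs.2 ⟨hm.1, fun q hq hc => ?_⟩, hm.2, ?_⟩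
  · exact hmax q (Finset.mem_filter.2 ⟨hq, hm.2.trans hc⟩)
  · exact hmax k (Finset.mem_filter.2 ⟨hk, Conn.refl _ _⟩)

theorem lastPairs_eq (hinj : Function.Injective ord) :
    ∀ m ∈ lastPairs ord K T, ∀ m' ∈ lastPairs ord K T, Conn T m.1 m'.1 → m = m' := by
  intro m hm m' hm' hc
  rw [mem_lastPairs] at hm hm'
  exact hinj (le_antisymm (hm'.2 _ hm.1 hc.symm) (hm.2 _ hm'.1 hc))

/-- Each last pair of `K'` is sent to the last pair of `K` in the same component of `T`, which is no
shorter. A component has only one last pair of `K'`, so the map is injective. -/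
theorem weight_lastPairs_mono (hd : IsPseudoDist d) (hinj : Function.Injective ord)
    (hord : ∀ k q, ord k ≤ ord q → d k.1 k.2 ≤ d q.1 q.2) {K' : Finset (V × V)} (hK : K' ⊆ K) :
    weight d (lastPairs ord K' T) ≤ weight d (lastPairs ord K T) := by
  classical
  have h : ∀ k : V × V, ∃ m, k ∈ K' → m ∈ lastPairs ord K T ∧ Conn T k.1 m.1 ∧ ord k ≤ ord m := by
    intro k
    by_cases hk : k ∈ K'
    · obtain ⟨m, hm⟩ := exists_lastPairs (ord := ord) (T := T) (hK hk)
      exact ⟨m, fun _ => hm⟩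
    · exact ⟨k, fun h => absurd h hk⟩
  choose f hf using h
  have hsub : lastPairs ord K' T ⊆ K' := lastPairs_subset
  have hinjf : Set.InjOn f (lastPairs ord K' T : Set (V × V)) := by
    intro m hm m' hm' heq
    have h1 := (hf m (hsub hm)).2.1
    have h2 := (hf m' (hsub hm')).2.1
    rw [← heq] at h2
    exact lastPairs_eq hinj m hm m' hm' (h1.trans h2.symm)
  calc weight d (lastPairs ord K' T) ≤ ∑ m ∈ lastPairs ord K' T, d (f m).1 (f m).2 :=
        Finset.sum_le_sum fun m hm => hord _ _ (hf m (hsub hm)).2.2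
    _ = weight d ((lastPairs ord K' T).image f) := by
        rw [weight, Finset.sum_image hinjf]
    _ ≤ _ := weight_mono hd fun m hm => by
        obtain ⟨k, hk, rfl⟩ := Finset.mem_image.1 hm
        exact (hf k (hsub hk)).1

/-- The cost of an optimal forest for fewer pairs. -/
theorem IsOptimalForest.weight_le (hd : IsPseudoDist d) (hinj : Function.Injective ord)
    (hord : ∀ k q, ord k ≤ ord q → d k.1 k.2 ≤ d q.1 q.2) {K' F R : Finset (V × V)}
    (hopt : IsOptimalForest d K' F R) (hK : K' ⊆ K) (hT : ∀ k ∈ K, Conn T k.1 k.2) :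
    weight d F ≤ weight d T + 2 * weight d (lastPairs ord K T) := by
  -- `T` with its last pairs competes with the optimal forest, whose own penalty is then dropped.
  have h1 := hopt.minimal T (lastPairs ord K' T) ⟨lastPairs_subset,
    fun k hk => hT k (hK hk), fun k hk => by
      obtain ⟨m, hm, hc, hle⟩ := exists_lastPairs (ord := ord) (T := T) hk
      exact ⟨m, hm, hc, hord _ _ hle⟩⟩
  have h2 := weight_lastPairs_mono (T := T) hd hinj hord hK
  have h3 := weight_nonneg hd R
  linarith

/-- Distinct last pairs lie in disjoint components, each of which connects its pair and so weighs at
least its length. -/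
theorem weight_lastPairs_le (hd : IsPseudoDist d) (hinj : Function.Injective ord)
    (hT : ∀ k ∈ K, Conn T k.1 k.2) : weight d (lastPairs ord K T) ≤ weight d T := by
  refine le_trans (Finset.sum_le_sum fun m hm => ?_)
    (sum_weight_component_le hd (lastPairs_eq (K := K) hinj))
  exact dist_le_weight hd (conn_component (Conn.refl _ _)
    (hT m (lastPairs_subset hm)))

/-- All pairs can be processed one after the other. -/
theorem exists_admissible [DecidableEq V] (hd : IsPseudoDist d) (hinj : Function.Injective ord)
    (hord : ∀ k q, ord k ≤ ord q → d k.1 k.2 ≤ d q.1 q.2) {F R : V × V → Finset (V × V)}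
    (hopt : ∀ j ∈ K, IsOptimalForest d (K.erase j) (F j) (R j)) {g : V × V → ℝ}
    (hg : ∀ j ∈ K, ∀ A, Conn (F j ∪ A) j.1 j.2 → g j ≤ weight d A)
    (hg' : ∀ j ∈ K, ∃ A, Conn (F j ∪ A) j.1 j.2 ∧ weight d A = g j) (D : Finset (V × V))
    (hDK : D ⊆ K) (hD : ∀ x ∈ D, ∀ y ∈ K, y ∉ D → ord x < ord y) :
    ∃ zs, Admissible d (laterPairs ord K) zs ∧ (∀ B ∈ zs, B.owner ∈ D) ∧
      ∀ χ : V × V → ℝ, (zs.map fun B => B.radius * χ B.owner).sum = ∑ k ∈ D, g k / 3 * χ k := by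
  -- Pairs enter in increasing order, so the pairs still to come are later than every owner so far.
  induction D using Finset.induction_on_max_value ord with
  | empty => exact ⟨[], trivial, by simp, by simp⟩
  | insert j s hjs hmax ih =>
    have hjK : j ∈ K := hDK (Finset.mem_insert_self _ _)
    have hlt : ∀ x ∈ s, ord x < ord j := fun x hx =>
      lt_of_le_of_ne (hmax x hx) fun h => hjs (by rwa [← hinj h])
    obtain ⟨zs, h1, h2, h3⟩ := ih ((Finset.subset_insert _ _).trans hDK) fun x hx y hy hys => by
      by_cases hyj : y = j
      · rw [hyj]; exact hlt x hx
      · exact hD x (Finset.mem_insert_of_mem hx) y hy (by simp [hyj, hys])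
    obtain ⟨ns, g1, g2, g3⟩ := (hopt j hjK).exists_balls hd h1
      (fun B hB => Finset.mem_erase.2 ⟨fun h => hjs (h ▸ h2 B hB),
        hDK (Finset.mem_insert_of_mem (h2 B hB))⟩)
      (fun B hB => hord _ _ (hmax _ (h2 B hB))) (hg j hjK) (hg' j hjK)
      (fun B hB => Finset.mem_filter.2 ⟨hjK, hlt _ (h2 B hB)⟩)
      (fun q hq => by
        obtain ⟨hqK, hjq⟩ := Finset.mem_filter.1 hq
        exact ⟨Finset.mem_erase.2 ⟨fun h => (h ▸ hjq).false, hqK⟩, hord _ _ hjq.le,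
          fun B hB => Finset.mem_filter.2 ⟨hqK, (hlt _ (h2 B hB)).trans hjq⟩⟩)
    refine ⟨ns ++ zs, g3, fun B hB => ?_, fun χ => ?_⟩
    · rcases List.mem_append.1 hB with hB | hB
      · rw [g1 B hB]; exact Finset.mem_insert_self _ _
      · exact Finset.mem_insert_of_mem (h2 B hB)
    · rw [List.map_append, List.sum_append, h3, Finset.sum_insert hjs, ← g2,
        ← List.sum_map_mul_right]
      congr 2
      exact List.map_congr_left fun B hB => by rw [g1 B hB]

/-- The radii of the balls of a component are paid for by its edges. -/
theorem sum_radius_le [DecidableEq V] (hd : IsPseudoDist d) (hT : ∀ k ∈ K, Conn T k.1 k.2)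
    {Q : V × V → Finset (V × V)} (hQ : ∀ m ∈ lastPairs ord K T, Q m ⊆ component T m.1)
    (hQc : ∀ m ∈ lastPairs ord K T, Conn (Q m) m.1 m.2)
    (hQm : ∀ m ∈ lastPairs ord K T, ∀ e ∈ Q m, ¬ Conn ((Q m).erase e) m.1 m.2)
    (hinj : Function.Injective ord)
    {zs : List (Ball V)} (hadm : Admissible d (laterPairs ord K) zs)
    (hown : ∀ B ∈ zs, B.owner ∈ K) :
    (zs.map fun B => B.radius * if B.owner ∈ lastPairs ord K T then 1 / 2 else 1).sum ≤
      ∑ m ∈ lastPairs ord K T, ∑ e ∈ component T m.1, (1 - if e ∈ Q m then 1 / 2 else 0) *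
        (d e.1 e.2 - contracted d zs e.1 e.2) := by
  induction zs with
  | nil => simp [contracted]
  | cons B zs ih =>
    have ih' := ih hadm.2 fun B' hB' => hown B' (List.mem_cons_of_mem _ hB')
    obtain ⟨hB, hadm⟩ := hadm
    have hkK := hown B List.mem_cons_self
    set d' := contracted d zs with hd'def
    have hd' : IsPseudoDist d' := hd.contracted zs
    set φ : V → ℝ := fun v => min (d' B.center v) B.radius with hφ
    have hφ0 : φ B.center = 0 := by
      simp only [hφ, hd'.refl]; exact min_eq_left hB.nonneg
    have hφr : ∀ v, B.radius ≤ d' B.center v → φ v = B.radius := fun v hv => min_eq_right hv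
    obtain ⟨m, hm, hkm, hle⟩ := exists_lastPairs (ord := ord) (T := T) hkK
    have hzm : Conn T m.1 B.center := by
      rcases hB.own with h | h
      · rw [h.1]; exact hkm.symm
      · rw [h.1]; exact hkm.symm.trans (hT _ hkK)
    have hmain := half_add_half_le (hQ m hm) (hQc m hm) (hQm m hm)
      (conn_component hzm hzm.symm) (φ := φ) (M := B.radius)
      (fun v => ⟨le_min (hd'.nonneg _ _) hB.nonneg, min_le_right _ _⟩) hφ0
    -- For an owner other than `m`, both ends of the later pair `m` have potential equal to the
    -- radius, which is paid in full. A ball of `m` itself is centred at one end of `m`, and only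
    -- half its radius is paid.
    have hchi : B.radius * (if B.owner ∈ lastPairs ord K T then 1 / 2 else 1) ≤
        1 / 2 * φ m.1 + 1 / 2 * φ m.2 := by
      by_cases hkm' : B.owner = m
      · rw [if_pos (hkm' ▸ hm)]
        rcases hB.own with h | h
        · have h1 : φ m.1 = 0 := by rw [← hkm', ← h.1, hφ0]
          have h2 : φ m.2 = B.radius := by rw [← hkm']; exact hφr _ h.2
          rw [h1, h2]; linarith
        · have h1 : φ m.2 = 0 := by rw [← hkm', ← h.1, hφ0]
          have h2 : φ m.1 = B.radius := by rw [← hkm']; exact hφr _ h.2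
          rw [h1, h2]; linarith
      · have hlater : m ∈ laterPairs ord K B.owner := Finset.mem_filter.2
          ⟨lastPairs_subset hm, lt_of_le_of_ne hle fun h => hkm' (hinj h)⟩
        have h1 := hB.far_later m hlater
        have h0 := hB.nonneg
        rw [hφr m.1 (by rw [hd'.symm]; linarith [h1.1]),
          hφr m.2 (by rw [hd'.symm]; linarith [h1.2])]
        split_ifs <;> linarith
    have hα : ∀ (m e : V × V), (0 : ℝ) ≤ 1 - if e ∈ Q m then 1 / 2 else 0 := fun m e => by
      split_ifs <;> norm_num
    have hstep : 1 / 2 * φ m.1 + 1 / 2 * φ m.2 ≤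
        ∑ m ∈ lastPairs ord K T, ∑ e ∈ component T m.1, (1 - if e ∈ Q m then 1 / 2 else 0) *
          (d' e.1 e.2 - contract d' B.center B.radius e.1 e.2) := by
      refine hmain.trans (le_trans (Finset.sum_le_sum fun e _ => ?_)
        (Finset.single_le_sum (f := fun m => ∑ e ∈ component T m.1,
          (1 - if e ∈ Q m then 1 / 2 else 0) *
          (d' e.1 e.2 - contract d' B.center B.radius e.1 e.2)) (fun m _ =>
            Finset.sum_nonneg fun e _ => mul_nonneg (hα m e)
              (sub_nonneg.2 (contract_le _ _ _ _ _))) hm))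
      refine mul_le_mul_of_nonneg_left ?_ (hα m e)
      have := abs_sub_add_contract_le hd' B.center B.radius e.1 e.2
      simp only [hφ]
      linarith
    rw [List.map_cons, List.sum_cons]
    refine (add_le_add (hchi.trans hstep) ih').trans (le_of_eq ?_)
    rw [← Finset.sum_add_distrib]
    refine Finset.sum_congr rfl fun m _ => ?_
    rw [← Finset.sum_add_distrib]
    refine Finset.sum_congr rfl fun e _ => ?_
    simp only [contracted]
    ring

/-- The total cost of connecting each pair, given an optimal forest for the other pairs. -/
theorem sum_augment_le [DecidableEq V] (hd : IsPseudoDist d) (hinj : Function.Injective ord)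
    (hord : ∀ k q, ord k ≤ ord q → d k.1 k.2 ≤ d q.1 q.2) {F R : V × V → Finset (V × V)}
    (hopt : ∀ j ∈ K, IsOptimalForest d (K.erase j) (F j) (R j)) {g : V × V → ℝ}
    (hg : ∀ j ∈ K, ∀ A, Conn (F j ∪ A) j.1 j.2 → g j ≤ weight d A)
    (hg' : ∀ j ∈ K, ∃ A, Conn (F j ∪ A) j.1 j.2 ∧ weight d A = g j)
    (hT : ∀ k ∈ K, Conn T k.1 k.2) :
    ∑ j ∈ K, g j ≤ 3 * weight d T - weight d (lastPairs ord K T) := by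
  obtain ⟨zs, hadm, hown, hχ⟩ := exists_admissible hd hinj hord hopt hg hg' K subset_rfl
    fun _ _ y hy hy' => absurd hy hy'
  have hLK : lastPairs ord K T ⊆ K := lastPairs_subset
  have hQ : ∀ m : V × V, ∃ Q, m ∈ lastPairs ord K T → Q ⊆ component T m.1 ∧ Conn Q m.1 m.2 ∧
      ∀ e ∈ Q, ¬ Conn (Q.erase e) m.1 m.2 := by
    intro m
    by_cases hm : m ∈ lastPairs ord K T
    · obtain ⟨Q, hQ⟩ := exists_minimal_conn (conn_component (Conn.refl T m.1) (hT m (hLK hm)))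
      exact ⟨Q, fun _ => hQ⟩
    · exact ⟨∅, fun h => absurd h hm⟩
  choose Q hQ using hQ
  have h1 := sum_radius_le (ord := ord) hd hT (fun m hm => (hQ m hm).1)
    (fun m hm => (hQ m hm).2.1) (fun m hm => (hQ m hm).2.2) hinj hadm hown
  rw [hχ fun k => if k ∈ lastPairs ord K T then 1 / 2 else 1] at h1
  have h2 : ∀ m ∈ lastPairs ord K T,
      ∑ e ∈ component T m.1, (1 - if e ∈ Q m then 1 / 2 else 0) *
        (d e.1 e.2 - contracted d zs e.1 e.2) ≤
      weight d (component T m.1) - 1 / 2 * d m.1 m.2 := by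
    intro m hm
    have h3 : ∑ e ∈ component T m.1, (1 - if e ∈ Q m then (1 / 2 : ℝ) else 0) * d e.1 e.2 =
        weight d (component T m.1) - 1 / 2 * weight d (Q m) := by
      simp only [sub_mul, one_mul, Finset.sum_sub_distrib, ite_mul, zero_mul]
      rw [← Finset.sum_filter, Finset.filter_mem_eq_inter, Finset.inter_eq_right.2 (hQ m hm).1,
        weight, weight, Finset.mul_sum]
    have h4 := dist_le_weight hd (hQ m hm).2.1
    refine le_trans (Finset.sum_le_sum fun e _ => ?_) (by rw [h3]; linarith)
    refine mul_le_mul_of_nonneg_left ?_ (by split_ifs <;> norm_num)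
    linarith [(hd.contracted zs).nonneg e.1 e.2]
  have h3 := h1.trans (Finset.sum_le_sum h2)
  rw [Finset.sum_sub_distrib, ← Finset.mul_sum] at h3
  have h4 := sum_weight_component_le hd (lastPairs_eq (K := K) (T := T) hinj)
  have h5 : ∑ k ∈ K, g k / 3 * (if k ∈ lastPairs ord K T then 1 / 2 else 1) =
      1 / 3 * ∑ k ∈ K, g k - 1 / 6 * ∑ k ∈ lastPairs ord K T, g k := by
    rw [Finset.mul_sum, Finset.mul_sum, ← Finset.inter_eq_right.2 hLK,
      ← Finset.filter_mem_eq_inter, Finset.sum_filter, ← Finset.sum_sub_distrib]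
    refine Finset.sum_congr rfl fun k hk => ?_
    rw [Finset.filter_mem_eq_inter, Finset.inter_eq_right.2 hLK]
    split_ifs <;> ring
  -- With L the weight of the last pairs, the half-paid balls lose at most L/6 while the halved
  -- paths gain L/2. Multiplying the difference L/3 by 3 gives the term -L.
  have h6 : ∑ k ∈ lastPairs ord K T, g k ≤ weight d (lastPairs ord K T) :=
    Finset.sum_le_sum fun k hk => by
      have := hg k (hLK hk) {k} (Conn.of_mem (by simp))
      simpa [weight] using this
  change _ ≤ _ - 1 / 2 * weight d (lastPairs ord K T) at h3
  linarith

/-- Ties in length are broken lexicographically by an enumeration of the pairs. -/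
theorem exists_order_by_length [Finite V] (d : V → V → ℝ) :
    ∃ ord : V × V → ℝ ×ₗ ℕ, Function.Injective ord ∧
      ∀ k q, ord k ≤ ord q → d k.1 k.2 ≤ d q.1 q.2 := by
  obtain ⟨n, ⟨f⟩⟩ := Finite.exists_equiv_fin (V × V)
  refine ⟨fun p => toLex (d p.1 p.2, (f p : ℕ)), fun p q h => ?_, fun k q h => ?_⟩
  · have := congrArg (fun x => (ofLex x).2) h
    exact f.injective (Fin.ext this)
  · rcases Prod.Lex.le_iff.1 h with h | h
    · exact h.le
    · exact h.1.le

end Accounting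

/-! ### Undirected network design: the factor 5. -/

section Undirected

open ShortestPath

theorem iInf_expectedSocialCost_undirectedGame_le {V : Type*} [Finite V] (G : SimpleGraph V)
    (c : G.edgeSet → ℝ≥0) (n : ℕ) (ρ : PMF {p : V × V // G.Reachable p.1 p.2}) :
    (⨅ s : {s // (undirectedGame G c (fun _ : Fin n => ρ)).IsStrategyProfile s},
      (undirectedGame G c (fun _ : Fin n => ρ)).expectedSocialCost s.1) ≤
      (5 : ℝ≥0) * (undirectedGame G c (fun _ : Fin n => ρ)).expectedOptCost := by
  obtain _ | m := n
  · exact BayesianNetworkDesignGame.iInf_expectedSocialCost_zero _ _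
  have := Classical.decEq V
  set d := pathDist c with hdef
  have hd : IsPseudoDist d := isPseudoDist_pathDist c
  obtain ⟨ord, hinj, hord⟩ := exists_order_by_length d
  choose F R hopt using exists_isOptimalForest d
  have haug : ∀ (K : Finset (V × V)) (k : V × V), ∃ A, Conn (F K ∪ A) k.1 k.2 ∧
      ∀ A', Conn (F K ∪ A') k.1 k.2 → weight d A ≤ weight d A' := fun K k =>
    exists_min_weight d _ ⟨{k}, Conn.of_mem (by simp)⟩
  choose aug haug haug' using haug
  let vals : ∀ {k : ℕ}, (Fin k → {p : V × V // G.Reachable p.1 p.2}) → Finset (V × V) :=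
    fun Y => Finset.univ.image fun i => (Y i).1
  refine iInf_expectedSocialCost_network_le (undirectedGame G c (fun _ : Fin (m + 1) => ρ))
    (fun _ => rfl) (fun t => t.1) (fun t => t.2) (fun _ _ => rfl) (fun Y => F (vals Y))
    (fun Y t => aug (vals Y) t.1) (fun Y t => haug _ _) 5 (by norm_num) fun X A hA => ?_
  change ∑ j, weight d _ + _ * ∑ j, weight d _ ≤ _ * (_ * weight d A)
  set K := vals X with hK
  have hAK : ∀ k ∈ K, Conn A k.1 k.2 := fun k hk => by
    obtain ⟨i, _, rfl⟩ := Finset.mem_image.1 hk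
    exact hA i
  set L := weight d (lastPairs ord K A) with hL
  have hsub : ∀ j : Fin (m + 1), vals (j.removeNth X : Fin m → _) ⊆ K := fun j k hk => by
    obtain ⟨i, _, rfl⟩ := Finset.mem_image.1 hk
    exact Finset.mem_image_of_mem _ (Finset.mem_univ _)
  have h1 : ∑ j : Fin (m + 1), weight d (F (vals (j.removeNth X : Fin m → _))) ≤
      (m + 1) * (weight d A + 2 * L) := by
    refine (Finset.sum_le_card_nsmul _ _ (weight d A + 2 * L) fun j _ => ?_).trans
      (le_of_eq (by simp [nsmul_eq_mul]; ring))
    exact (hopt _).weight_le hd hinj hord (hsub j) hAK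
  have h2 : L ≤ weight d A := weight_lastPairs_le hd hinj hAK
  let g : V × V → ℝ := fun k => weight d (aug (K.erase k) k)
  have h3 : ∑ k ∈ K, g k ≤ 3 * weight d A - L :=
    sum_augment_le hd hinj hord (F := fun k => F (K.erase k)) (R := fun k => R (K.erase k))
      (fun k _ => hopt _) (fun k _ B hB => haug' _ _ B hB) (fun k _ => ⟨_, haug _ _, rfl⟩) hAK
  -- A player whose pair also occurs in the sample is connected for free; every other pair is held
  -- by just one player.
  let J : Finset (Fin (m + 1)) :=
    Finset.univ.filter fun j => (X j).1 ∉ vals (j.removeNth X : Fin m → _)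
  have hJ : ∀ j ∈ J, ∀ i, i ≠ j → (X i).1 ≠ (X j).1 := fun j hj i hij heq => by
    obtain ⟨k, rfl⟩ := Fin.exists_succAbove_eq hij
    exact (Finset.mem_filter.1 hj).2 (Finset.mem_image.2 ⟨k, Finset.mem_univ _, heq⟩)
  have h4 : ∑ j : Fin (m + 1), weight d (aug (vals (j.removeNth X : Fin m → _)) (X j).1) ≤
      ∑ k ∈ K, g k := by
    calc _ ≤ ∑ j : Fin (m + 1), if j ∈ J then g (X j).1 else 0 := by
          refine Finset.sum_le_sum fun j _ => ?_
          split_ifs with hj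
          · have : vals (j.removeNth X : Fin m → _) = K.erase (X j).1 := by
              ext k
              rw [Finset.mem_erase]
              constructor
              · intro hk
                refine ⟨fun h => (Finset.mem_filter.1 hj).2 (h ▸ hk), hsub j hk⟩
              · rintro ⟨hne, hk⟩
                obtain ⟨i, _, rfl⟩ := Finset.mem_image.1 hk
                obtain ⟨i', rfl⟩ := Fin.exists_succAbove_eq (fun h : i = j => hne (by rw [h]))
                exact Finset.mem_image.2 ⟨i', Finset.mem_univ _, rfl⟩
            rw [this]
          · have hmem : (X j).1 ∈ vals (j.removeNth X : Fin m → _) := by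
              by_contra h
              exact hj (Finset.mem_filter.2 ⟨Finset.mem_univ _, h⟩)
            refine (haug' _ _ ∅ ?_).trans (by simp [weight])
            rw [Finset.union_empty]
            exact (hopt _).conn _ hmem
      _ = ∑ j ∈ J, g (X j).1 := by
          rw [← Finset.sum_filter, Finset.filter_mem_eq_inter, Finset.univ_inter]
      _ = ∑ k ∈ J.image fun j => (X j).1, g k := by
          rw [Finset.sum_image]
          intro j hj j' hj' heq
          by_contra hne
          exact hJ j hj j' (Ne.symm hne) heq.symm
      _ ≤ ∑ k ∈ K, g k := by
          refine Finset.sum_le_sum_of_subset_of_nonneg (fun k hk => ?_)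
            fun k _ _ => weight_nonneg hd _
          obtain ⟨i, _, rfl⟩ := Finset.mem_image.1 hk
          exact Finset.mem_image_of_mem _ (Finset.mem_univ _)
  have h5 : (0 : ℝ) ≤ (m : ℝ) + 1 := by positivity
  have h6 := mul_le_mul_of_nonneg_left (h4.trans h3) h5
  have h7 := mul_le_mul_of_nonneg_left h2 h5
  push_cast
  linarith

end Undirected

/-! ### Logarithmic bounds and the main theorem. -/

section Stability

open BayesianNetworkDesignGame

/-- H_n ≤ 1 + log n, and n ≥ 2 lets the 1 be absorbed as log n / log 2. -/
theorem harm_mul_le {n : ℕ} (hn : 2 ≤ n) (β : ℝ≥0) {C : ℝ} (hC : (1 / Real.log 2 + 1) * β ≤ C) :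
    (harm n : ℝ≥0∞) * β ≤ ENNReal.ofReal (C * Real.log n) := by
  have h1 : ((harm n : ℝ≥0) : ℝ) = ((harmonic n : ℚ) : ℝ) := by
    simp [harm, harmonic]
  have h2 := harmonic_le_one_add_log n
  have h3 : 0 < Real.log 2 := Real.log_pos one_lt_two
  have h4 : Real.log 2 ≤ Real.log n := Real.log_le_log two_pos (by exact_mod_cast hn)
  have h5 : 1 ≤ 1 / Real.log 2 * Real.log n := by
    rw [one_div, inv_mul_eq_div, le_div_iff₀ h3]; linarith
  rw [← ENNReal.coe_mul, ENNReal.ofReal, ENNReal.coe_le_coe]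
  refine NNReal.le_toNNReal_of_coe_le ?_
  rw [NNReal.coe_mul, h1]
  calc ((harmonic n : ℚ) : ℝ) * β ≤ ((1 / Real.log 2 + 1) * Real.log n) * β := by
        gcongr; linarith
    _ = ((1 / Real.log 2 + 1) * β) * Real.log n := by ring
    _ ≤ _ := by gcongr

theorem pathEdgeSets_nonempty {V : Type*} [Finite V] {G : SimpleGraph V} {x y : V}
    (h : G.Reachable x y) : (pathEdgeSets G x y).Nonempty := by
  have := Fintype.ofFinite G.edgeSet
  obtain ⟨a, ha, _⟩ := ShortestPath.Linked.exists_path (S := Finset.univ) (Or.inr fun e =>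
    Finset.mem_univ e) h
  exact ⟨a, ha⟩

end Stability

theorem mainTheorem5 :
    -- information gap bounds for i.i.d. types
    (∀ (V : Type u) [Finite V] (G : SimpleGraph V) (c : G.edgeSet → ℝ≥0) (r : V) (n : ℕ)
        (ρ : PMF {s : V // G.Reachable s r}),
        (multicastGame G c r (fun _ : Fin n => ρ)).informationGap ≤ 3) ∧
    (∀ (V : Type u) [Finite V] (G : SimpleGraph V) (c : G.edgeSet → ℝ≥0) (n : ℕ)
        (ρ : PMF {p : V × V // G.Reachable p.1 p.2}),
        (undirectedGame G c (fun _ : Fin n => ρ)).informationGap ≤ 5) ∧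
    (∀ (V : Type u) [Finite V] (c : V → ℝ≥0) (n : ℕ) (ρ : PMF (V × V)),
        (vertexCoverGame c (fun _ : Fin n => ρ)).informationGap ≤ 6) ∧
    (∀ (V : Type u) [Finite V] (d : ℕ) (_ : 1 ≤ d) (c : V → ℝ≥0) (n : ℕ)
        (ρ : PMF {h : Finset V // h.card = d}),
        (hypergraphCoverGame d c (fun _ : Fin n => ρ)).informationGap ≤ 2 * ((d : ℝ≥0∞) + 1)) ∧
    -- the Bayesian price of stability is `O(log n)`, uniformly over all games
    (∃ C : ℝ, 0 < C ∧ ∀ n : ℕ, 2 ≤ n →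
      (∀ (V : Type u) [Finite V] (G : SimpleGraph V) (c : G.edgeSet → ℝ≥0) (r : V)
          (ρ : PMF {s : V // G.Reachable s r}),
          (multicastGame G c r (fun _ : Fin n => ρ)).bayesianPriceOfStability
            ≤ ENNReal.ofReal (C * Real.log n)) ∧
      (∀ (V : Type u) [Finite V] (G : SimpleGraph V) (c : G.edgeSet → ℝ≥0)
          (ρ : PMF {p : V × V // G.Reachable p.1 p.2}),
          (undirectedGame G c (fun _ : Fin n => ρ)).bayesianPriceOfStability
            ≤ ENNReal.ofReal (C * Real.log n)) ∧
      (∀ (V : Type u) [Finite V] (c : V → ℝ≥0) (ρ : PMF (V × V)),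
          (vertexCoverGame c (fun _ : Fin n => ρ)).bayesianPriceOfStability
            ≤ ENNReal.ofReal (C * Real.log n)) ∧
      (∀ (V : Type u) [Finite V] (d : ℕ) (_ : 1 ≤ d) (c : V → ℝ≥0)
          (ρ : PMF {h : Finset V // h.card = d}),
          (hypergraphCoverGame d c (fun _ : Fin n => ρ)).bayesianPriceOfStability
            ≤ ENNReal.ofReal (C * ((d : ℝ) + 1) * Real.log n))) := by
  -- The constant 6 is the largest of the gap bounds 3, 5 and 6, and 2(d + 1) ≤ 6(d + 1) covers
  -- hypergraphs.
  refine ⟨fun V _ G c r n ρ => ?_, fun V _ G c n ρ => ?_, fun V _ c n ρ => ?_,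
    fun V _ d hd c n ρ => ?_, 6 * (1 / Real.log 2 + 1), ?_, fun n hn =>
      ⟨fun V _ G c r ρ => ?_, fun V _ G c ρ => ?_, fun V _ c ρ => ?_, fun V _ d hd c ρ => ?_⟩⟩
  · exact (BayesianNetworkDesignGame.informationGap_le _
      (iInf_expectedSocialCost_multicastGame_le G c r n ρ)).trans (by simp)
  · exact (BayesianNetworkDesignGame.informationGap_le _
      (iInf_expectedSocialCost_undirectedGame_le G c n ρ)).trans (by simp)
  · exact (BayesianNetworkDesignGame.informationGap_le _
      (iInf_expectedSocialCost_vertexCoverGame_le c n ρ)).trans (by simp)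
  · exact (BayesianNetworkDesignGame.informationGap_le _
      (iInf_expectedSocialCost_hypergraphCoverGame_le hd c n ρ)).trans (by simp)
  · have := Real.log_pos one_lt_two
    positivity
  all_goals have hlog2 := Real.log_pos one_lt_two
  all_goals have hlog : 0 < 1 / Real.log 2 + 1 := by positivity
  · exact (BayesianNetworkDesignGame.bayesianPriceOfStability_le _
      (fun _ t => pathEdgeSets_nonempty t.2)
      (iInf_expectedSocialCost_multicastGame_le G c r n ρ)).trans
      (harm_mul_le hn _ (by push_cast; linarith))
  · exact (BayesianNetworkDesignGame.bayesianPriceOfStability_le _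
      (fun _ t => pathEdgeSets_nonempty t.2)
      (iInf_expectedSocialCost_undirectedGame_le G c n ρ)).trans
      (harm_mul_le hn _ (by push_cast; linarith))
  · exact (BayesianNetworkDesignGame.bayesianPriceOfStability_le _
      (fun _ t => ⟨{t.1}, Or.inl rfl⟩)
      (iInf_expectedSocialCost_vertexCoverGame_le c n ρ)).trans
      (harm_mul_le hn _ (by push_cast; linarith))
  · exact (BayesianNetworkDesignGame.bayesianPriceOfStability_le _
      (fun _ t => by
        obtain ⟨v, hv⟩ := Finset.card_pos.1 (show 0 < t.1.card by rw [t.2]; omega)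
        exact ⟨{v}, v, hv, rfl⟩)
      (iInf_expectedSocialCost_hypergraphCoverGame_le hd c n ρ)).trans
      (harm_mul_le hn _ (by
        have : (0 : ℝ) ≤ (1 / Real.log 2 + 1) * ((d : ℝ) + 1) := by positivity
        push_cast; linarith))
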